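/- Let $\mathcal P$ be a filtered poset, i.e. a poset with a strictly order-preserving map $d\colon\mathcal P\to\mathbb N$, viewed as a category with one arrow $q\to p$ whenever $q\le p$. Let $R$ be a unital commutative ring, $F\colon\mathcal P^{\mathrm{op}}\to R\text{-Mod}$ a functor, and $n\ge 1$ an integer. For $p\in\mathcal P$ put $\mathcal P_{<p}=\{q\in\mathcal P : q<p\}$, and let $H^k(\mathcal P_{<p};F)$ be the $k$-th right derived functor of $\lim\colon \mathrm{Fun}(\mathcal P_{<p}^{\mathrm{op}},R\text{-Mod})\to R\text{-Mod}$ applied to $F|_{\mathcal P_{<p}}$. The height $h(C)$ of a cochain complex $C$ of $R$-modules is the supremum of the degrees $k$ with $C^k\neq 0$ (so $h(0)=-\infty$), and for a functor $G\colon\mathcal P^{\mathrm{op}}\to \mathrm{Ch}(R)$ we put $h(G)=\sup_{p\in\mathcal P} h(G(p))$. For a cochain map $f\colon C\to D$, let $\mathrm{cocyl}(f)$ be the complex with $\mathrm{cocyl}(f)^k=C^k\times D^{k-1}\times D^k$ and $\partial(c,x,y)=(\partial c,\;y-f(c)-\partial x,\;\partial y)$; $f$ factors as $C\to\mathrm{cocyl}(f)\to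 D$, $c\mapsto(c,0,f(c))$, $(c,x,y)\mapsto y$. The map $f$ is called truncatable if $h(C)<h(D)=m$ for some integer $m$ and $\partial\colon D^{m-1}\to D^{m}$ is surjective. In that case let $\mathbf TD$ be the complex that agrees with $D$ in degrees $\le m-1$ and is $0$ in degrees $\ge m$, let $\mathbf Tf\colon C\to\mathbf TD$ be the map induced by $f$, and put $\mathrm{cocyl}_{\mathbf T}(f)=\mathrm{cocyl}(\mathbf Tf)$; $f$ factors as $C\to\mathrm{cocyl}_{\mathbf T}(f)\to D$, where the first map is $c\mapsto (c,0,\mathbf Tf(c))$ and the second is $(c,x,y)\mapsto y$ in degrees $\le m-1$, $(c,x,y)\mapsto\partial x$ in degree $m$, and $0$ in degrees $>m$. Consider $F$ as a functor to $\mathrm{Ch}(R)$ concentrated in degree $0$. The explicit fibrant replacement $\mathbf RF\colon\mathcal P^{\mathrm{op}}\to\mathrm{Ch}(R)$ is defined by induction on $d(p)$. If $\mathbf RF$ is defined on $\mathcal P_{<p}$, let $\varepsilon_p$ be the composite $F(p)\to\lim_{\mathcal P_{<p}}F\to\lim_{\mathcal P_{<p}}\mathbf RF$. Then $\mathbf RF(p)$,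 together with the map $\mathbf RF(p)\to\lim_{\mathcal P_{<p}}\mathbf RF$, is given by: - the trivial factorisation $\mathbf RF(p)=F(p)$ of $\varepsilon_p$, if for every $q\le p$ the natural map $F(q)\to\lim_{\mathcal P_{<q}}F$ is surjective; - otherwise, $\mathbf RF(p)=\mathrm{cocyl}_{\mathbf T}(\varepsilon_p)$ with the factorisation above, if $\varepsilon_p$ is truncatable; - otherwise, $\mathbf RF(p)=\mathrm{cocyl}(\varepsilon_p)$ with the factorisation above. Then the following three conditions are equivalent: 1. $H^k(\mathcal P_{<p};F)=0$ for every $p\in\mathcal P$ and every $k\ge n$; 2. $H^n(\mathcal P_{<p};F)=0$ for every $p\in\mathcal P$; 3. $h(\mathbf RF)\le n$. -/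

import Mathlib

open CategoryTheory Limits Opposite

universe u

noncomputable section

namespace PosetLim

/-! ### Functors on a poset: restriction, matching morphisms, higher limits -/

section Poset

variable {P : Type u} [PartialOrder P] {V : Type (u + 1)} [Category.{u} V]

/-- The inclusion of the full subposet `P_{<p}` into `P`. -/
def belowInclusion (p : P) : Set.Iio p ⥤ P :=
  Monotone.functor (f := fun q : Set.Iio p => (q : P)) (fun _ _ h => h)

/-- The restriction of a functor `K : Pᵒᵖ ⥤ V` to the subposet `P_{<p}`. -/
def restrictBelow (K : Pᵒᵖ ⥤ V) (p : P) : (Set.Iio p)ᵒᵖ ⥤ V :=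
  (belowInclusion p).op ⋙ K

variable [HasLimitsOfSize.{u, u} V]

/-- The matching morphism `K(p) ⟶ lim_{P_{<p}} K`. -/
def matchingMap (K : Pᵒᵖ ⥤ V) (p : P) : K.obj (op p) ⟶ limit (restrictBelow K p) :=
  limit.lift (restrictBelow K p)
    { pt := K.obj (op p)
      π :=
        { app := fun q => K.map (homOfLE (le_of_lt q.unop.2)).op
          naturality := fun _ _ _ =>
            (Category.id_comp _).trans
              ((congrArg K.map (Subsingleton.elim _ _)).trans (K.map_comp _ _)) } }

/-- The projection `lim_{P_{<p}} K ⟶ K(q)` for `q < p`. -/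
def projBelow (K : Pᵒᵖ ⥤ V) {p q : P} (h : q < p) :
    limit (restrictBelow K p) ⟶ K.obj (op q) :=
  limit.π (restrictBelow K p) (op (⟨q, h⟩ : Set.Iio p))

lemma matchingMap_proj (K : Pᵒᵖ ⥤ V) {p q : P} (h : q < p) :
    matchingMap K p ≫ projBelow K h = K.map (homOfLE h.le).op :=
  limit.lift_π _ _

lemma projBelow_map (K : Pᵒᵖ ⥤ V) {p q r : P} (h : q < p) (h' : r < q) :
    projBelow K h ≫ K.map (homOfLE h'.le).op = projBelow K (h'.trans h) :=
  limit.w (restrictBelow K p)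
    (homOfLE (show (⟨r, h'.trans h⟩ : Set.Iio p) ≤ ⟨q, h⟩ from h'.le)).op

/-- The trivial factorisation `C = C ⟶ D` of a morphism `C ⟶ D`. -/
def trivialFactorisation {C D : V} (f : C ⟶ D) : Factorisation f where
  mid := C
  ι := 𝟙 C
  π := f

/-- Given a factorisation `K(p) ⟶ E(p) ⟶ lim_{P_{<p}} K` of every matching morphism of `K`, the
morphism `E(p) ⟶ E(q)` for `q ≤ p`: the identity if `q = p`, and the composite
`E(p) ⟶ lim_{P_{<p}} K ⟶ K(q) ⟶ E(q)` if `q < p`. -/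
def stepMap (K : Pᵒᵖ ⥤ V) (fac : ∀ p, Factorisation (matchingMap K p)) {p q : P} (h : q ≤ p) :
    (fac p).mid ⟶ (fac q).mid := by
  classical
  exact if e : p = q then eqToHom (by rw [e])
    else (fac p).π ≫ projBelow K (lt_of_le_of_ne h (Ne.symm e)) ≫ (fac q).ι

/-- The functor `p ↦ E(p)` obtained from factorisations `K(p) ⟶ E(p) ⟶ lim_{P_{<p}} K`. -/
def step (K : Pᵒᵖ ⥤ V) (fac : ∀ p, Factorisation (matchingMap K p)) : Pᵒᵖ ⥤ V where
  obj p := (fac p.unop).mid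
  map f := stepMap K fac (leOfHom f.unop)
  map_id p := by simp [stepMap]
  map_comp {a b c} f g := by
    have h₁ : b.unop ≤ a.unop := leOfHom f.unop
    have h₂ : c.unop ≤ b.unop := leOfHom g.unop
    obtain ⟨a⟩ := a
    obtain ⟨b⟩ := b
    obtain ⟨c⟩ := c
    dsimp only at h₁ h₂ ⊢
    rcases h₁.eq_or_lt with rfl | h₁
    · simp [stepMap]
    rcases h₂.eq_or_lt with rfl | h₂
    · simp [stepMap]
    have e₃ := (h₂.trans h₁).ne'
    simp only [stepMap, h₁.ne', h₂.ne', e₃, dite_false, Category.assoc]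
    rw [Factorisation.ι_π_assoc, ← Category.assoc (matchingMap K b), matchingMap_proj,
      ← Category.assoc (projBelow K h₁), projBelow_map K h₁ h₂]

/-- The natural transformation `K ⟶ E`. -/
def stepι (K : Pᵒᵖ ⥤ V) (fac : ∀ p, Factorisation (matchingMap K p)) : K ⟶ step K fac where
  app p := (fac p.unop).ι
  naturality {a b} f := by
    have h : b.unop ≤ a.unop := leOfHom f.unop
    obtain ⟨a⟩ := a
    obtain ⟨b⟩ := b
    dsimp only at h
    rcases h.eq_or_lt with rfl | h
    · have : f = 𝟙 _ := Subsingleton.elim _ _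
      subst this
      exact ((congrArg (fun t => t ≫ (fac b).ι) (K.map_id _)).trans (Category.id_comp _)).trans
        ((congrArg (fun t => (fac b).ι ≫ t) ((step K fac).map_id _)).trans
          (Category.comp_id _)).symm
    · have : f = (homOfLE h.le).op := Subsingleton.elim _ _
      subst this
      simp only [step, stepMap, h.ne', dite_false]
      rw [Factorisation.ι_π_assoc, ← Category.assoc, matchingMap_proj]

end Poset

section HigherLimits

variable {R : Type u} [CommRing R] {J : Type u} [PartialOrder J]

instance isGrothendieckAbelian_functor : IsGrothendieckAbelian.{u} (Jᵒᵖ ⥤ ModuleCat.{u} R) where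
  hasFilteredColimitsOfSize := inferInstance
  ab5OfSize := { ofShape := fun K _ _ => inferInstance }
  hasSeparator := inferInstance

instance lim_additive : (lim : (Jᵒᵖ ⥤ ModuleCat.{u} R) ⥤ ModuleCat.{u} R).Additive :=
  Functor.additive_of_preserves_binary_products _

/-- The higher limit `H^k(J; F)`: the `k`-th right derived functor of
`lim : Fun(Jᵒᵖ, R-Mod) ⥤ R-Mod` applied to `F`. -/
def higherLimit (F : Jᵒᵖ ⥤ ModuleCat.{u} R) (k : ℕ) : ModuleCat.{u} R :=
  ((lim : (Jᵒᵖ ⥤ ModuleCat.{u} R) ⥤ ModuleCat.{u} R).rightDerived k).obj F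

end HigherLimits

/-! ### Cochain complexes: height, mapping cocylinder, truncated mapping cocylinder -/

section Complexes

variable {R : Type u} [CommRing R]

/-- The height of a cochain complex: the supremum of the degrees `k` with `C^k ≠ 0`. For a nonzero
complex bounded above this is the largest such degree; the zero complex has height `⊥`. -/
def height (C : CochainComplex (ModuleCat.{u} R) ℤ) : WithBot (WithTop ℤ) :=
  ⨆ (k : ℤ) (_ : ¬ IsZero (C.X k)), ((k : WithTop ℤ) : WithBot (WithTop ℤ))

/-- The height of a functor with values in cochain complexes: the supremum of the heights of its
values. -/
def functorHeight {P : Type u} [PartialOrder P]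
    (K : Pᵒᵖ ⥤ CochainComplex (ModuleCat.{u} R) ℤ) : WithBot (WithTop ℤ) :=
  ⨆ p : P, height (K.obj (op p))

lemma isZero_of_height_lt {C : CochainComplex (ModuleCat.{u} R) ℤ} {k : ℤ}
    (h : height C < ((k : WithTop ℤ) : WithBot (WithTop ℤ))) : IsZero (C.X k) := by
  by_contra hk
  exact absurd (le_iSup₂_of_le (f := fun (k : ℤ) (_ : ¬ IsZero (C.X k)) =>
    ((k : WithTop ℤ) : WithBot (WithTop ℤ))) k hk le_rfl) (not_le.mpr h)

lemma d_d_apply (C : CochainComplex (ModuleCat.{u} R) ℤ) (i j k : ℤ) (x : C.X i) :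
    (C.d j k).hom ((C.d i j).hom x) = 0 :=
  LinearMap.congr_fun (congrArg ModuleCat.Hom.hom (C.d_comp_d i j k)) x

lemma comm_apply {C D : CochainComplex (ModuleCat.{u} R) ℤ} (f : C ⟶ D) (i j : ℤ) (x : C.X i) :
    (D.d i j).hom ((f.f i).hom x) = (f.f j).hom ((C.d i j).hom x) :=
  LinearMap.congr_fun (congrArg ModuleCat.Hom.hom (f.comm i j)) x

variable {C D : CochainComplex (ModuleCat.{u} R) ℤ}

/-- The differential `(c, d, d') ↦ (∂c, d' - f(c) - ∂d, ∂d')` of the mapping cocylinder, from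
degree `i` to degree `j = i + 1`. The isomorphism `XIsoOfEq` identifies `D^i` with `D^{j-1}`. -/
def cocylD (f : C ⟶ D) (i j : ℤ) (h : i = j - 1) :
    (C.X i × D.X (i - 1) × D.X i) →ₗ[R] (C.X j × D.X (j - 1) × D.X j) where
  toFun x :=
    ((C.d i j).hom x.1,
      (D.XIsoOfEq h).hom.hom (x.2.2 - (f.f i).hom x.1) - (D.d (i - 1) (j - 1)).hom x.2.1,
      (D.d i j).hom x.2.2)
  map_add' x y := by
    refine Prod.ext ?_ (Prod.ext ?_ ?_)
    · simp
    · simp only [Prod.fst_add, Prod.snd_add, map_add, map_sub]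
      abel
    · simp
  map_smul' r x := by
    ext <;> simp [smul_sub]

lemma cocylD_cocylD (f : C ⟶ D) (i j k : ℤ) (h : i = j - 1) (h' : j = k - 1)
    (x : C.X i × D.X (i - 1) × D.X i) : cocylD f j k h' (cocylD f i j h x) = 0 := by
  subst h'
  subst h
  obtain ⟨c, y, z⟩ := x
  refine Prod.ext ?_ (Prod.ext ?_ ?_)
  · exact d_d_apply C _ _ _ _
  · simp [cocylD, d_d_apply, comm_apply]
  · exact d_d_apply D _ _ _ _

/-- The mapping cocylinder of `f : C ⟶ D`: `cocyl(f)^k = C^k × D^{k-1} × D^k`. -/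
def cocyl (f : C ⟶ D) : CochainComplex (ModuleCat.{u} R) ℤ where
  X k := ModuleCat.of R (C.X k × D.X (k - 1) × D.X k)
  d i j := if h : i = j - 1 then ModuleCat.ofHom (cocylD f i j h) else 0
  shape i j hij := dif_neg (by
    simp only [ComplexShape.up_Rel] at hij
    omega)
  d_comp_d' i j k hij hjk := by
    simp only [ComplexShape.up_Rel] at hij hjk
    obtain rfl : j = i + 1 := hij.symm
    obtain rfl : k = i + 1 + 1 := hjk.symm
    rw [dif_pos (by omega), dif_pos (by omega)]
    exact ModuleCat.hom_ext (LinearMap.ext (fun x => cocylD_cocylD f _ _ _ _ _ x))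

lemma cocyl_d (f : C ⟶ D) {i j : ℤ} (h : i = j - 1) :
    (cocyl f).d i j = ModuleCat.ofHom (cocylD f i j h) :=
  dif_pos h

/-- The factorisation `C ⟶ cocyl(f) ⟶ D`, `c ↦ (c, 0, f(c))` and `(c, d, d') ↦ d'`. -/
def cocylFactorisation (f : C ⟶ D) : Factorisation f where
  mid := cocyl f
  ι :=
    { f := fun k => ModuleCat.ofHom
        (LinearMap.prod LinearMap.id (LinearMap.prod 0 (f.f k).hom))
      comm' := fun i j hij => by
        simp only [ComplexShape.up_Rel] at hij
        rw [cocyl_d f (by omega)]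
        refine ModuleCat.hom_ext (LinearMap.ext (fun x => ?_))
        refine Prod.ext rfl (Prod.ext ?_ ?_)
        · change (D.XIsoOfEq _).hom.hom ((f.f i).hom x - (f.f i).hom x) -
            (D.d (i - 1) (j - 1)).hom 0 = 0
          rw [sub_self, map_zero, map_zero, sub_zero]
        · exact comm_apply f i j x }
  π :=
    { f := fun k => ModuleCat.ofHom
        ((LinearMap.snd R (D.X (k - 1)) (D.X k)).comp
          (LinearMap.snd R (C.X k) (D.X (k - 1) × D.X k)))
      comm' := fun i j hij => by
        simp only [ComplexShape.up_Rel] at hij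
        rw [cocyl_d f (by omega)]
        rfl }
  ι_π := rfl

/-- `f : C ⟶ D` is truncatable: `h(C) < h(D)`, and the last differential
`D^{h(D)-1} ⟶ D^{h(D)}` is an epimorphism. -/
def Truncatable (f : C ⟶ D) : Prop :=
  height C < height D ∧
    ∃ m : ℤ, height D = ((m : WithTop ℤ) : WithBot (WithTop ℤ)) ∧ Epi (D.d (m - 1) m)

/-- The degree `k` part of the truncation `T D`: all of `D^k` if `k ≤ n`, and `0` if `k > n`. -/
def truncX (D : CochainComplex (ModuleCat.{u} R) ℤ) (n k : ℤ) : Submodule R (D.X k) where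
  carrier := {x | n < k → x = 0}
  add_mem' hx hy h := by rw [hx h, hy h, add_zero]
  zero_mem' _ := rfl
  smul_mem' r x hx h := by rw [hx h, smul_zero]

/-- The map `C^i → (T D)^j` that agrees with `g : C^i → D^j` if `j ≤ n`, and is `0` if `j > n`. -/
def toTruncX {M : Type u} [AddCommGroup M] [Module R M]
    (D : CochainComplex (ModuleCat.{u} R) ℤ) (n j : ℤ) (g : M →ₗ[R] D.X j) :
    M →ₗ[R] truncX D n j :=
  if h : j ≤ n then g.codRestrict (truncX D n j) (fun _ h' => absurd h (not_le.mpr h')) else 0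

lemma toTruncX_of_le {M : Type u} [AddCommGroup M] [Module R M] {n j : ℤ} (h : j ≤ n)
    (g : M →ₗ[R] D.X j) (x : M) : (toTruncX D n j g x : D.X j) = g x := by
  rw [toTruncX, dif_pos h]; rfl

lemma truncX_eq_zero {n j : ℤ} (h : n < j) (x : truncX D n j) : x = 0 :=
  Subtype.ext (x.2 h)

/-- The truncation `T D` of `D` above degree `n`. -/
def trunc (D : CochainComplex (ModuleCat.{u} R) ℤ) (n : ℤ) :
    CochainComplex (ModuleCat.{u} R) ℤ where
  X k := ModuleCat.of R (truncX D n k)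
  d i j := ModuleCat.ofHom (toTruncX D n j ((D.d i j).hom.comp (truncX D n i).subtype))
  shape i j hij := by
    refine ModuleCat.hom_ext (LinearMap.ext (fun x => ?_))
    by_cases h : j ≤ n
    · refine Subtype.ext ((toTruncX_of_le h _ x).trans ?_)
      rw [D.shape i j hij]
      rfl
    · exact truncX_eq_zero (not_le.mp h) _
  d_comp_d' i j k hij hjk := by
    refine ModuleCat.hom_ext (LinearMap.ext (fun x => ?_))
    simp only [ComplexShape.up_Rel] at hjk
    by_cases h : k ≤ n
    · refine Subtype.ext ((toTruncX_of_le h _ _).trans ?_)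
      refine (congrArg (D.d j k).hom (toTruncX_of_le (show j ≤ n by omega) _ x)).trans ?_
      exact d_d_apply D i j k x.1
    · exact truncX_eq_zero (not_le.mp h) _

/-- The truncation `T f : C ⟶ T D` of `f : C ⟶ D`. -/
def truncMap (f : C ⟶ D) (n : ℤ) : C ⟶ trunc D n where
  f k := ModuleCat.ofHom (toTruncX D n k (f.f k).hom)
  comm' i j hij := by
    refine ModuleCat.hom_ext (LinearMap.ext (fun x => ?_))
    simp only [ComplexShape.up_Rel] at hij
    by_cases h : j ≤ n
    · refine Subtype.ext ((toTruncX_of_le h _ _).trans ?_)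
      refine (congrArg (D.d i j).hom (toTruncX_of_le (show i ≤ n by omega) _ x)).trans ?_
      exact (comm_apply f i j x).trans (toTruncX_of_le h _ _).symm
    · exact (truncX_eq_zero (not_le.mp h) _).trans (truncX_eq_zero (not_le.mp h) _).symm

/-- The degree `k` part `(c, d, d') ↦ d'` if `k ≤ n`, `(c, d, d') ↦ ∂d` if `k = n + 1`, and `0` if
`k > n + 1`, of the projection of the truncated mapping cocylinder onto `D`. -/
def truncCocylProj (C D : CochainComplex (ModuleCat.{u} R) ℤ) (n k : ℤ) :
    (C.X k × truncX D n (k - 1) × truncX D n k) →ₗ[R] D.X k :=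
  if k ≤ n then
    (truncX D n k).subtype.comp ((LinearMap.snd R (truncX D n (k - 1)) (truncX D n k)).comp
      (LinearMap.snd R (C.X k) (truncX D n (k - 1) × truncX D n k)))
  else if k = n + 1 then
    ((D.d (k - 1) k).hom.comp (truncX D n (k - 1)).subtype).comp
      ((LinearMap.fst R (truncX D n (k - 1)) (truncX D n k)).comp
        (LinearMap.snd R (C.X k) (truncX D n (k - 1) × truncX D n k)))
  else 0

lemma truncCocylProj_of_le {n k : ℤ} (h : k ≤ n)
    (x : C.X k × truncX D n (k - 1) × truncX D n k) :
    truncCocylProj C D n k x = (x.2.2 : D.X k) := by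
  rw [truncCocylProj, if_pos h]
  rfl

lemma truncCocylProj_of_eq {n k : ℤ} (h : k = n + 1)
    (x : C.X k × truncX D n (k - 1) × truncX D n k) :
    truncCocylProj C D n k x = (D.d (k - 1) k).hom (x.2.1 : D.X (k - 1)) := by
  rw [truncCocylProj, if_neg (by omega), if_pos h]
  rfl

lemma truncCocylProj_of_gt {n k : ℤ} (h : n + 1 < k)
    (x : C.X k × truncX D n (k - 1) × truncX D n k) :
    truncCocylProj C D n k x = 0 := by
  rw [truncCocylProj, if_neg (by omega), if_neg (by omega)]
  rfl

lemma eq_zero_of_height_lt {n k : ℤ}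
    (hC : height C < (((n + 1 : ℤ) : WithTop ℤ) : WithBot (WithTop ℤ))) (h : n < k)
    (x : C.X k) : x = 0 := by
  have h₁ : n + 1 ≤ k := h
  have hz : IsZero (C.X k) := isZero_of_height_lt (hC.trans_le (by exact_mod_cast h₁))
  exact (ModuleCat.subsingleton_of_isZero hz).elim _ _

lemma truncCocylProj_comm (f : C ⟶ D) (n j : ℤ)
    (hC : height C < (((n + 1 : ℤ) : WithTop ℤ) : WithBot (WithTop ℤ)))
    (c : C.X (j - 1)) (y : truncX D n (j - 1 - 1)) (z : truncX D n (j - 1)) :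
    (D.d (j - 1) j).hom (truncCocylProj C D n (j - 1) (c, y, z)) =
      truncCocylProj C D n j ((C.d (j - 1) j).hom c,
        z - toTruncX D n (j - 1) (f.f (j - 1)).hom c -
          toTruncX D n (j - 1)
            ((D.d (j - 1 - 1) (j - 1)).hom.comp (truncX D n (j - 1 - 1)).subtype) y,
        toTruncX D n j ((D.d (j - 1) j).hom.comp (truncX D n (j - 1)).subtype) z) := by
  rcases lt_trichotomy j (n + 1) with h | h | h
  · rw [truncCocylProj_of_le (by omega), truncCocylProj_of_le (by omega)]
    exact (toTruncX_of_le (show j ≤ n by omega)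
      ((D.d (j - 1) j).hom.comp (truncX D n (j - 1)).subtype) z).symm
  · have h' : j - 1 ≤ n := by omega
    have e : (D.d (j - 1) j).hom ((f.f (j - 1)).hom c) = 0 := by
      rw [comm_apply, eq_zero_of_height_lt hC (by omega) ((C.d (j - 1) j).hom c), map_zero]
    have e' : (D.d (j - 1) j).hom (((D.d (j - 1 - 1) (j - 1)).hom.comp
        (truncX D n (j - 1 - 1)).subtype) y) = 0 := d_d_apply D _ _ _ _
    rw [truncCocylProj_of_le h', truncCocylProj_of_eq h, Submodule.coe_sub (truncX D n (j - 1)),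
      Submodule.coe_sub (truncX D n (j - 1)), toTruncX_of_le h', toTruncX_of_le h', map_sub,
      map_sub, e, e', sub_zero, sub_zero]
  · rw [truncCocylProj_of_gt h]
    rcases eq_or_ne j (n + 2) with h' | h'
    · rw [truncCocylProj_of_eq (by omega)]
      exact d_d_apply D _ _ _ _
    · rw [truncCocylProj_of_gt (by omega), map_zero]

/-- The factorisation `C ⟶ cocyl_T(f) ⟶ D` of a morphism `f` with `h(C) < h(D) = n + 1` through
the truncated mapping cocylinder `cocyl_T(f) = cocyl(T f : C ⟶ T D)`. -/
def truncCocylFactorisation (f : C ⟶ D) (n : ℤ)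
    (hC : height C < (((n + 1 : ℤ) : WithTop ℤ) : WithBot (WithTop ℤ))) : Factorisation f where
  mid := cocyl (truncMap f n)
  ι := (cocylFactorisation (truncMap f n)).ι
  π :=
    { f := fun k => ModuleCat.ofHom (truncCocylProj C D n k)
      comm' := fun i j hij => by
        simp only [ComplexShape.up_Rel] at hij
        obtain rfl : i = j - 1 := by omega
        rw [cocyl_d (truncMap f n) rfl]
        exact ModuleCat.hom_ext (LinearMap.ext (fun x =>
          truncCocylProj_comm f n j hC x.1 x.2.1 x.2.2)) }
  ι_π := by
    ext k x
    change truncCocylProj C D n k (x, (0 : truncX D n (k - 1)), toTruncX D n k (f.f k).hom x) =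
      (f.f k).hom x
    by_cases h : k ≤ n
    · rw [truncCocylProj_of_le h]
      exact toTruncX_of_le h _ x
    · rw [eq_zero_of_height_lt hC (not_le.mp h) x, map_zero, map_zero]
      exact map_zero (truncCocylProj C D n k)

/-- The chosen factorisation of `f : C ⟶ D`: the trivial one if the condition `lf` holds; else
through the truncated mapping cocylinder if `f` is truncatable; else through the mapping
cocylinder. -/
def chosenFactorisation (lf : Prop) (f : C ⟶ D) : Factorisation f := by
  classical
  exact
    if lf then trivialFactorisation f
    else if h : Truncatable f then
      truncCocylFactorisation f (h.2.choose - 1) (by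
        rw [sub_add_cancel, ← h.2.choose_spec.1]
        exact h.1)
    else cocylFactorisation f

end Complexes

/-! ### The explicit fibrant replacement -/

section FibrantReplacement

variable {R : Type u} [CommRing R] {P : Type u} [PartialOrder P]

/-- `F` is locally fibrant at `p`: the matching morphism `F(q) ⟶ lim_{P_{<q}} F` is an epimorphism
for every `q ≤ p`. -/
def LocallyFibrant (F : Pᵒᵖ ⥤ ModuleCat.{u} R) (p : P) : Prop :=
  ∀ q ≤ p, Epi (matchingMap F q)

/-- The stages of the inductive construction of the fibrant replacement `RF`. The `n`-th stage is
a functor with value `RF(p)` if `d(p) < n` and `F(p)` (in degree `0`) otherwise. It starts with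
`F`, and the `(n + 1)`-st stage replaces the value `F(p)` at every `p` with `d(p) = n` by the middle
term of the chosen factorisation of `ε_p : F(p) ⟶ lim_{P_{<p}} RF`. -/
def stage (d : P → ℕ) (F : Pᵒᵖ ⥤ ModuleCat.{u} R) :
    ℕ → (Pᵒᵖ ⥤ CochainComplex (ModuleCat.{u} R) ℤ)
  | 0 => F ⋙ HomologicalComplex.single (ModuleCat.{u} R) (ComplexShape.up ℤ) 0
  | n + 1 => step (stage d F n) (fun p =>
      if d p = n then chosenFactorisation (LocallyFibrant F p) (matchingMap (stage d F n) p)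
      else trivialFactorisation (matchingMap (stage d F n) p))

/-- The natural morphism from the `m`-th stage to the `n`-th stage, for `m ≤ n`. -/
def stageMap (d : P → ℕ) (F : Pᵒᵖ ⥤ ModuleCat.{u} R) {m n : ℕ} (h : m ≤ n) :
    stage d F m ⟶ stage d F n :=
  (Functor.ofSequence (X := stage d F) (fun _ => stepι _ _)).map (homOfLE h)

lemma stageMap_refl (d : P → ℕ) (F : Pᵒᵖ ⥤ ModuleCat.{u} R) (n : ℕ) :
    stageMap d F (le_refl n) = 𝟙 _ :=
  (Functor.ofSequence (X := stage d F) (fun _ => stepι _ _)).map_id n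

lemma stageMap_trans (d : P → ℕ) (F : Pᵒᵖ ⥤ ModuleCat.{u} R) {l m n : ℕ} (h : l ≤ m)
    (h' : m ≤ n) : stageMap d F (h.trans h') = stageMap d F h ≫ stageMap d F h' :=
  (Functor.ofSequence (X := stage d F) (fun _ => stepι _ _)).map_comp (homOfLE h) (homOfLE h')

lemma stageMap_succ (d : P → ℕ) (F : Pᵒᵖ ⥤ ModuleCat.{u} R) (n : ℕ) :
    stageMap d F n.le_succ = stepι (stage d F n) _ :=
  Functor.ofSequence_map_homOfLE_succ _ n

lemma isIso_stageMap_succ (d : P → ℕ) (F : Pᵒᵖ ⥤ ModuleCat.{u} R) (n : ℕ) (p : P)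
    (h : d p ≠ n) : IsIso ((stageMap d F n.le_succ).app (op p)) := by
  rw [stageMap_succ]
  have : ∀ a : Factorisation (matchingMap (stage d F n) p),
      a = trivialFactorisation (matchingMap (stage d F n) p) → IsIso a.ι := by
    rintro _ rfl
    exact IsIso.id _
  exact this _ (if_neg h)

/-- The value of the stages at `p` does not change any more after the stage `d(p) + 1`. -/
lemma isIso_stageMap (d : P → ℕ) (F : Pᵒᵖ ⥤ ModuleCat.{u} R) (p : P) {m n : ℕ} (hmn : m ≤ n)
    (h : d p < m) : IsIso ((stageMap d F hmn).app (op p)) := by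
  induction n, hmn using Nat.le_induction with
  | base =>
    rw [stageMap_refl]
    exact IsIso.id _
  | succ n hmn ih =>
    rw [stageMap_trans d F hmn n.le_succ, NatTrans.comp_app]
    have := isIso_stageMap_succ d F n p (by omega)
    exact IsIso.comp_isIso

/-- For `d(q) ≤ d(p)`, the identification of the value at `q` of the stage `d(p) + 1` with the one
of the stage `d(q) + 1`. -/
def stageIso (d : P → ℕ) (F : Pᵒᵖ ⥤ ModuleCat.{u} R) {p q : P} (h : d q ≤ d p) :
    (stage d F (d q + 1)).obj (op q) ≅ (stage d F (d p + 1)).obj (op q) :=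
  haveI := isIso_stageMap d F q (Nat.succ_le_succ h) (Nat.lt_succ_self _)
  asIso ((stageMap d F (Nat.succ_le_succ h)).app (op q))

lemma degree_le_of_hom {d : P → ℕ} (hd : StrictMono d) {p q : Pᵒᵖ} (f : p ⟶ q) :
    d q.unop ≤ d p.unop :=
  hd.monotone (leOfHom f.unop)

/-- The explicit fibrant replacement `RF`. Its value at `p` is the value produced by the stage that
treats the elements of degree `d(p)`, that is, the middle term of the chosen factorisation of
`ε_p : F(p) ⟶ lim_{P_{<p}} RF`. For `q ≤ p` the morphism `RF(p) ⟶ RF(q)` is the one of the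
stage `d(p) + 1`, followed by the identification of the values of the stages `d(p) + 1` and
`d(q) + 1` at `q`. -/
def fibrantReplacement (d : P → ℕ) (hd : StrictMono d) (F : Pᵒᵖ ⥤ ModuleCat.{u} R) :
    Pᵒᵖ ⥤ CochainComplex (ModuleCat.{u} R) ℤ where
  obj p := (stage d F (d p.unop + 1)).obj p
  map {p q} f := (stage d F (d p.unop + 1)).map f ≫
    (stageIso d F (p := p.unop) (q := q.unop) (degree_le_of_hom hd f)).inv
  map_id p := by
    rw [Iso.comp_inv_eq]
    exact ((stage d F (d p.unop + 1)).map_id p).trans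
      ((NatTrans.congr_app (stageMap_refl d F (d p.unop + 1)) p).symm.trans
        (Category.id_comp _).symm)
  map_comp {p q r} f g := by
    have h₁ : d q.unop ≤ d p.unop := degree_le_of_hom hd f
    have h₂ : d r.unop ≤ d q.unop := degree_le_of_hom hd g
    have e : (stageIso d F (p := p.unop) (q := r.unop) (h₂.trans h₁)).hom =
        (stageIso d F (p := q.unop) (q := r.unop) h₂).hom ≫
          (stageMap d F (Nat.succ_le_succ h₁)).app r :=
      NatTrans.congr_app (stageMap_trans d F (Nat.succ_le_succ h₂) (Nat.succ_le_succ h₁)) r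
    have n : (stage d F (d q.unop + 1)).map g ≫ (stageMap d F (Nat.succ_le_succ h₁)).app r =
        (stageIso d F (p := p.unop) (q := q.unop) h₁).hom ≫ (stage d F (d p.unop + 1)).map g :=
      (stageMap d F (Nat.succ_le_succ h₁)).naturality g
    rw [Iso.comp_inv_eq, e, Category.assoc, Category.assoc, Category.assoc, Iso.inv_hom_id_assoc, n,
      Iso.inv_hom_id_assoc, Functor.map_comp]

end FibrantReplacement

end PosetLim

end

/-! Call a functor fibrant if all its matching maps are surjective. Compatible families in such a
functor can be extended by recursion along a well-founded poset, so `lim` sends acyclic bounded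
below complexes of fibrant functors to acyclic complexes (`acyclic_lim`), and hence preserves
quasi-isomorphisms between bounded below complexes of fibrant functors. Injective functors are
fibrant, so any fibrant resolution computes higher limits in positive degrees
(`isZero_higherLimit_iff`).

All chosen factorisations begin with a quasi-isomorphism, and the maps to the limits are degreewise
surjective (for a trivial factorisation, by local fibrancy). Hence the replacement below `p` is a
fibrant resolution of `F` there. With `D` the limit over `P_{<p}` of the replacement, `H^k(P_{<p};
F)` vanishes for `k ≥ 1` iff `D` is exact in degree `k` (`isZero_higherLimit_restrictBelow_iff`).

The rest is a count of degrees. If `D` is zero above degree `n ≥ 1`, then exactness in degree `n`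
means that `D^{n-1} → D^n` is surjective. Given this, either `D^n = 0` and the cocylinder stays
within height `n`, or `D` has height `n`, the map from `F(p)` is truncatable, and truncation removes
the excess degree (`height_chosenFactorisation_le`); induction along `P` bounds the height.
Conversely, a nontrivial value of height at most `n` forces this surjectivity
(`epi_of_isZero_chosenFactorisation`), and in the trivial case `D` lives in degree `0`. Above degree
`n`, vanishing of `D` suffices. -/

noncomputable section

namespace PosetLim

/-! ### Compatible families and fibrant functors -/

section Sections

variable {R : Type u} [CommRing R] {J : Type u} [PartialOrder J]

/-- The family `f` is compatible with the restriction maps of `G` out of the elements of `S`. -/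
def CompatOn (G : Jᵒᵖ ⥤ ModuleCat.{u} R) (S : Set J) (f : ∀ q, G.obj (op q)) : Prop :=
  ∀ q ∈ S, ∀ (r : J) (h : r < q), (G.map (homOfLE h.le).op).hom (f q) = f r

/-- Every compatible family over `J_{<q}` extends to an element over `q`. -/
def Fib (G : Jᵒᵖ ⥤ ModuleCat.{u} R) : Prop :=
  ∀ (q : J) (f : ∀ q, G.obj (op q)), CompatOn G (Set.Iio q) f →
    ∃ x : G.obj (op q), ∀ (r : J) (h : r < q), (G.map (homOfLE h.le).op).hom x = f r

/-- Every compatible family over `J_{<q}` in the kernel of `φ` extends to an element over `q` in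
the kernel of `φ`. -/
def KerFib {G H : Jᵒᵖ ⥤ ModuleCat.{u} R} (φ : G ⟶ H) : Prop :=
  ∀ (q : J) (f : ∀ q, G.obj (op q)), CompatOn G (Set.Iio q) f →
    (∀ r < q, (φ.app (op r)).hom (f r) = 0) →
    ∃ x : G.obj (op q), (φ.app (op q)).hom x = 0 ∧
      ∀ (r : J) (h : r < q), (G.map (homOfLE h.le).op).hom x = f r

lemma map_map_apply (G : Jᵒᵖ ⥤ ModuleCat.{u} R) {r s q : J} (h : r ≤ s) (h' : s ≤ q)
    (x : G.obj (op q)) : (G.map (homOfLE h).op).hom ((G.map (homOfLE h').op).hom x) =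
      (G.map (homOfLE (h.trans h')).op).hom x :=
  (LinearMap.congr_fun (congrArg ModuleCat.Hom.hom
    (G.map_comp (homOfLE h').op (homOfLE h).op)) x).symm

lemma naturality_apply {G H : Jᵒᵖ ⥤ ModuleCat.{u} R} (φ : G ⟶ H) {a b : Jᵒᵖ} (f : a ⟶ b)
    (x : G.obj a) : (φ.app b).hom ((G.map f).hom x) = (H.map f).hom ((φ.app a).hom x) :=
  LinearMap.congr_fun (congrArg ModuleCat.Hom.hom (φ.naturality f)) x

open Classical in
/-- The extension by zero of a family of elements over `J_{<q}`. -/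
def extendBelow (G : Jᵒᵖ ⥤ ModuleCat.{u} R) (q : J) (g : ∀ r, r < q → G.obj (op r)) (r : J) :
    G.obj (op r) :=
  if h : r < q then g r h else 0

lemma extendBelow_of_lt (G : Jᵒᵖ ⥤ ModuleCat.{u} R) {q : J} (g : ∀ r, r < q → G.obj (op r))
    {r : J} (h : r < q) : extendBelow G q g r = g r h :=
  dif_pos h

/-- Compatible families with a property can be built by well-founded recursion. -/
theorem exists_compatOn [WellFoundedLT J] (G : Jᵒᵖ ⥤ ModuleCat.{u} R) {S : Set J}
    (hS : IsLowerSet S) (Pr : ∀ q, G.obj (op q) → Prop)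
    (H : ∀ q ∈ S, ∀ f : ∀ q, G.obj (op q), CompatOn G (Set.Iio q) f → (∀ r < q, Pr r (f r)) →
      ∃ x, Pr q x ∧ ∀ (r : J) (h : r < q), (G.map (homOfLE h.le).op).hom x = f r) :
    ∃ f, CompatOn G S f ∧ ∀ q ∈ S, Pr q (f q) := by
  classical
  -- The default value `0` is never taken at elements of `S`: there the induction below supplies an
  -- extension.
  let F : ∀ q, (∀ r, r < q → G.obj (op r)) → G.obj (op q) := fun q g =>
    if h : ∃ x, Pr q x ∧ ∀ (r : J) (h : r < q), (G.map (homOfLE h.le).op).hom x = g r h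
    then h.choose else 0
  let b : ∀ q, G.obj (op q) := IsWellFounded.fix (· < ·) F
  have hb : ∀ q, b q = F q (fun r _ => b r) := fun q => IsWellFounded.fix_eq (· < ·) F q
  have key : ∀ q, q ∈ S → Pr q (b q) ∧
      ∀ (r : J) (h : r < q), (G.map (homOfLE h.le).op).hom (b q) = b r := by
    intro q
    induction q using IsWellFounded.induction (· < · : J → J → Prop) with
    | _ q ih =>
    intro hq
    have hex : ∃ x, Pr q x ∧ ∀ (r : J) (h : r < q), (G.map (homOfLE h.le).op).hom x = b r :=
      H q hq b (fun s hs r hr => (ih s hs (hS hs.le hq)).2 r hr)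
        (fun r hr => (ih r hr (hS hr.le hq)).1)
    have e : b q = hex.choose := (hb q).trans (dif_pos hex)
    rw [e]
    exact hex.choose_spec
  exact ⟨b, fun q hq => (key q hq).2, fun q hq => (key q hq).1⟩

/-- Compatible families of cocycles lift along `φ` if the kernel of `φ` is fibrant. -/
theorem exists_lift [WellFoundedLT J] {G H L : Jᵒᵖ ⥤ ModuleCat.{u} R} {φ : G ⟶ H} {ψ : H ⟶ L}
    (hφ : KerFib φ) (hex : ∀ q y, (ψ.app q).hom y = 0 → ∃ x, (φ.app q).hom x = y)
    {S : Set J} (hS : IsLowerSet S) {c : ∀ q, H.obj (op q)} (hc : CompatOn H S c)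
    (hc' : ∀ q ∈ S, (ψ.app (op q)).hom (c q) = 0) :
    ∃ f, CompatOn G S f ∧ ∀ q ∈ S, (φ.app (op q)).hom (f q) = c q := by
  refine exists_compatOn G hS (fun q x => (φ.app (op q)).hom x = c q) ?_
  intro q hq f hf hf'
  obtain ⟨x₀, hx₀⟩ := hex (op q) (c q) (hc' q hq)
  -- An arbitrary preimage `x₀` over `q` need not restrict to `f`, but the differences lie in the
  -- kernel of `φ`. Fibrancy of that kernel extends them to `a`, and `a + x₀` is the corrected
  -- preimage.
  obtain ⟨a, ha, ha'⟩ := hφ q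
    (extendBelow G q fun r h => f r - (G.map (homOfLE h.le).op).hom x₀) (by
      intro s hs r hr
      have hs' : s < q := hs
      have hr' : r < q := hr.trans hs'
      rw [extendBelow_of_lt _ _ hs', extendBelow_of_lt _ _ hr', map_sub, hf s hs r hr,
        map_map_apply]) (by
      intro r hr
      rw [extendBelow_of_lt _ _ hr, map_sub, hf' r hr, naturality_apply, hx₀, hc q hq r hr,
        sub_self])
  refine ⟨a + x₀, by rw [map_add, ha, hx₀, zero_add], fun r hr => ?_⟩
  rw [map_add, ha' r hr, extendBelow_of_lt _ _ hr, sub_add_cancel]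

/-- The inductive step from cocycles in one degree to cocycles in the next: a family in the kernel
of `ψ` lifts to `G`, extends over `q` there, and is pushed back along `φ`. -/
theorem KerFib.succ [WellFoundedLT J] {G H L : Jᵒᵖ ⥤ ModuleCat.{u} R} {φ : G ⟶ H} {ψ : H ⟶ L}
    (hG : Fib G) (hφ : KerFib φ) (hex : ∀ q y, (ψ.app q).hom y = 0 → ∃ x, (φ.app q).hom x = y)
    (h0 : φ ≫ ψ = 0) : KerFib ψ := by
  intro q f hf hf'
  obtain ⟨g, hg, hg'⟩ := exists_lift hφ hex (isLowerSet_Iio q) hf hf'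
  obtain ⟨x, hx⟩ := hG q g hg
  refine ⟨(φ.app (op q)).hom x, ?_, fun r hr => ?_⟩
  · exact LinearMap.congr_fun (congrArg ModuleCat.Hom.hom (NatTrans.congr_app h0 (op q))) x
  · rw [← naturality_apply, hx r hr, hg' r hr]

/-- Fibrancy passes to biproducts. -/
theorem Fib.of_decomp {G G₁ G₂ : Jᵒᵖ ⥤ ModuleCat.{u} R} (h₁ : Fib G₁) (h₂ : Fib G₂)
    (p₁ : G ⟶ G₁) (p₂ : G ⟶ G₂) (i₁ : G₁ ⟶ G) (i₂ : G₂ ⟶ G)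
    (h : p₁ ≫ i₁ + p₂ ≫ i₂ = 𝟙 G) : Fib G := by
  intro q f hf
  obtain ⟨x, hx⟩ := h₁ q (fun r => (p₁.app (op r)).hom (f r)) (fun s hs r hr => by
    rw [← naturality_apply, hf s hs r hr])
  obtain ⟨y, hy⟩ := h₂ q (fun r => (p₂.app (op r)).hom (f r)) (fun s hs r hr => by
    rw [← naturality_apply, hf s hs r hr])
  refine ⟨(i₁.app _).hom x + (i₂.app _).hom y, fun r hr => ?_⟩
  rw [map_add, ← naturality_apply, ← naturality_apply, hx r hr, hy r hr]
  exact LinearMap.congr_fun (congrArg ModuleCat.Hom.hom (NatTrans.congr_app h (op r))) (f r)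

theorem Fib.of_isZero {G : Jᵒᵖ ⥤ ModuleCat.{u} R} (h : ∀ q, IsZero (G.obj q)) : Fib G := by
  intro _ _ _
  exact ⟨0, fun r _ => (ModuleCat.subsingleton_of_isZero (h (op r))).elim _ _⟩

/-- A compatible family is a cone with apex `R` whose legs send `1` to its members; the induced map
to the limit is evaluated at `1`. -/
lemma exists_limit_apply {G : Jᵒᵖ ⥤ ModuleCat.{u} R} {f : ∀ q, G.obj (op q)}
    (hf : CompatOn G Set.univ f) :
    ∃ x : (limit G : ModuleCat.{u} R), ∀ q, (limit.π G (op q)).hom x = f q := by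
  let c : Cone G :=
    { pt := ModuleCat.of R R
      π :=
        { app := fun q => ModuleCat.ofHom (LinearMap.toSpanSingleton R _ (f q.unop))
          naturality := fun a b g => by
            refine ModuleCat.hom_ext (LinearMap.ext_ring ?_)
            obtain ⟨a⟩ := a
            obtain ⟨b⟩ := b
            have e : (G.map g).hom (f a) = f b := by
              rcases (leOfHom g.unop).eq_or_lt with h | h
              · dsimp at h
                subst h
                obtain rfl : g = 𝟙 _ := Subsingleton.elim _ _
                rw [G.map_id]
                rfl
              · exact hf a trivial b h
            simpa using e.symm } }
  refine ⟨(limit.lift G c).hom (1 : R), fun q => ?_⟩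
  refine (LinearMap.congr_fun (congrArg ModuleCat.Hom.hom (limit.lift_π c (op q))) (1 : R)).trans ?_
  exact one_smul R (f q)

lemma limit_apply_ext {G : Jᵒᵖ ⥤ ModuleCat.{u} R} {x y : (limit G : ModuleCat.{u} R)}
    (h : ∀ q, (limit.π G (op q)).hom x = (limit.π G (op q)).hom y) : x = y :=
  Concrete.limit_ext G x y (fun q => h q.unop)

lemma compatOn_limit_π (G : Jᵒᵖ ⥤ ModuleCat.{u} R) (S : Set J) (x : (limit G : ModuleCat.{u} R)) :
    CompatOn G S (fun q => (limit.π G (op q)).hom x) := fun _ _ _ h =>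
  LinearMap.congr_fun (congrArg ModuleCat.Hom.hom (limit.w G (homOfLE h.le).op)) x

/-- Matching maps are surjective iff compatible families extend. -/
lemma epi_matchingMap_iff (G : Jᵒᵖ ⥤ ModuleCat.{u} R) (q : J) :
    Epi (matchingMap G q) ↔ ∀ (f : ∀ q, G.obj (op q)), CompatOn G (Set.Iio q) f →
    ∃ x : G.obj (op q), ∀ (r : J) (h : r < q), (G.map (homOfLE h.le).op).hom x = f r := by
  have hm : ∀ (x : G.obj (op q)) (r : J) (h : r < q),
      (limit.π (restrictBelow G q) (op ⟨r, h⟩)).hom ((matchingMap G q).hom x) =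
        (G.map (homOfLE h.le).op).hom x := fun x r h =>
    LinearMap.congr_fun (congrArg ModuleCat.Hom.hom (matchingMap_proj G h)) x
  rw [ModuleCat.epi_iff_surjective]
  constructor
  · intro hs f hf
    obtain ⟨y, hy⟩ := exists_limit_apply (G := restrictBelow G q) (f := fun r => f r.1)
      (fun s _ r hr => hf s.1 s.2 r.1 hr)
    obtain ⟨x, rfl⟩ := hs y
    exact ⟨x, fun r h => (hm x r h).symm.trans (hy ⟨r, h⟩)⟩
  · intro H y
    obtain ⟨g, hg⟩ : ∃ g : ∀ r, r < q → G.obj (op r), ∀ r h, g r h =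
      (limit.π (restrictBelow G q) (op (⟨r, h⟩ : Set.Iio q))).hom y := ⟨_, fun _ _ => rfl⟩
    -- Extension by zero is harmless: compatibility on `Set.Iio q` involves only the values below
    -- `q`.
    obtain ⟨x, hx⟩ := H (extendBelow G q g) (by
        intro s hs r hr
        have hs' : s < q := hs
        rw [extendBelow_of_lt _ _ hs', extendBelow_of_lt _ _ (hr.trans hs'), hg, hg]
        exact compatOn_limit_π (restrictBelow G q) Set.univ y ⟨s, hs'⟩ trivial ⟨r, hr.trans hs'⟩ hr)
    refine ⟨x, limit_apply_ext (fun r => ?_)⟩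
    exact (hm x r.1 r.2).trans ((hx r.1 r.2).trans ((extendBelow_of_lt _ _ r.2).trans (hg _ _)))

/-! ### Fibrancy of injective functors, tested on constant functors over lower sets -/

/-- The submodule of `R` that is everything if `r ∈ S` and zero otherwise. -/
def lowerSubmodule (R : Type u) [CommRing R] (S : Set J) (r : J) : Submodule R R where
  carrier := {a | r ∈ S ∨ a = 0}
  add_mem' := by
    rintro a b (ha | ha) (hb | hb)
    · exact Or.inl ha
    · exact Or.inl ha
    · exact Or.inl hb
    · exact Or.inr (by rw [ha, hb, add_zero])
  zero_mem' := Or.inr rfl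
  smul_mem' c a ha := ha.imp_right (fun h => by rw [h, smul_zero])

/-- The constant functor `R` on a lower set, extended by zero. -/
def lowerFunctor (R : Type u) [CommRing R] (S : LowerSet J) : Jᵒᵖ ⥤ ModuleCat.{u} R where
  obj r := ModuleCat.of R (lowerSubmodule R (S : Set J) r.unop)
  map {_ _} f := ModuleCat.ofHom (Submodule.inclusion
    (fun _ ha => ha.imp_left (fun h => S.lower (leOfHom f.unop) h)))
  map_id _ := rfl
  map_comp _ _ := rfl

/-- The inclusion of the constant functors on lower sets `S ≤ T`. -/
def lowerFunctorMap (R : Type u) [CommRing R] {S T : LowerSet J} (h : S ≤ T) :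
    lowerFunctor R S ⟶ lowerFunctor R T where
  app _ := ModuleCat.ofHom (Submodule.inclusion (fun _ ha => ha.imp_left (fun h' => h h')))
  naturality _ _ _ := rfl

instance mono_lowerFunctorMap {S T : LowerSet J} (h : S ≤ T) : Mono (lowerFunctorMap R h) := by
  have : ∀ r, Mono ((lowerFunctorMap R h).app r) := fun r => by
    rw [ModuleCat.mono_iff_injective]
    exact fun x y hxy => Subtype.ext
      (congrArg (fun z : lowerSubmodule R (T : Set J) r.unop => (z : R)) hxy)
  exact NatTrans.mono_of_mono_app _

/-- The morphism out of the constant functor on `S` given by a family compatible on `S`. -/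
def lowerFunctorDesc {G : Jᵒᵖ ⥤ ModuleCat.{u} R} (S : LowerSet J) (f : ∀ q, G.obj (op q))
    (hf : CompatOn G (S : Set J) f) : lowerFunctor R S ⟶ G where
  app r := ModuleCat.ofHom ((LinearMap.toSpanSingleton R _ (f r.unop)).comp
    (lowerSubmodule R (S : Set J) r.unop).subtype)
  naturality a b g := by
    refine ModuleCat.hom_ext (LinearMap.ext fun x => ?_)
    obtain ⟨a⟩ := a
    obtain ⟨b⟩ := b
    obtain ⟨x, hx⟩ := x
    change x • f b = (G.map g).hom (x • f a)
    rcases hx with hx | rfl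
    · rcases (leOfHom g.unop).eq_or_lt with h | h
      · dsimp at h
        subst h
        obtain rfl : g = 𝟙 _ := Subsingleton.elim _ _
        rw [G.map_id]
        rfl
      · rw [map_smul]
        exact congrArg (x • ·) (hf a hx b h).symm
    · rw [zero_smul, zero_smul, map_zero]

/-- Injective functors are fibrant. -/
theorem Fib.of_injective (I : Jᵒᵖ ⥤ ModuleCat.{u} R) [Injective I] : Fib I := by
  intro q f hf
  -- The family is a morphism out of the constant functor on `J_{<q}`. Injectivity extends it to the
  -- constant functor on `J_{≤q}`, and the image of `1` over `q` is the desired element.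
  have hle : LowerSet.Iio q ≤ LowerSet.Iic q := fun _ (hr : _ < q) => hr.le
  let g := lowerFunctorDesc (G := I) (LowerSet.Iio q) f hf
  let h := Injective.factorThru g (lowerFunctorMap R hle)
  have hg : lowerFunctorMap R hle ≫ h = g := Injective.comp_factorThru _ _
  refine ⟨(h.app (op q)).hom ⟨1, Or.inl (show q ≤ q from le_rfl)⟩, fun r hr => ?_⟩
  refine (naturality_apply h _ _).symm.trans ?_
  refine (LinearMap.congr_fun (congrArg ModuleCat.Hom.hom (NatTrans.congr_app hg (op r)))
    ⟨1, Or.inl hr⟩).trans ?_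
  exact one_smul R (f r)

/-! ### Exactness of limits on complexes of fibrant functors -/

/-- Exactness of a complex of functors, on elements. -/
lemma exists_of_exactAt {X : CochainComplex (Jᵒᵖ ⥤ ModuleCat.{u} R) ℤ} {i : ℤ}
    (h : X.ExactAt i) (q : Jᵒᵖ) (y : (X.X i).obj q)
    (hy : ((X.d i (i + 1)).app q).hom y = 0) :
    ∃ x, ((X.d (i - 1) i).app q).hom x = y := by
  rw [X.exactAt_iff' (i - 1) i (i + 1) (by simp) (by simp)] at h
  exact (ShortComplex.moduleCat_exact_iff _).1
    (h.map ((evaluation Jᵒᵖ (ModuleCat.{u} R)).obj q)) y hy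

/-- The limit of an exact bounded below complex of fibrant functors is exact. -/
theorem acyclic_lim [WellFoundedLT J] (X : CochainComplex (Jᵒᵖ ⥤ ModuleCat.{u} R) ℤ) (a : ℤ)
    (h0 : ∀ k < a, IsZero (X.X k)) (hX : X.Acyclic) (hF : ∀ k, Fib (X.X k)) :
    (((lim : (Jᵒᵖ ⥤ ModuleCat.{u} R) ⥤ ModuleCat.{u} R).mapHomologicalComplex
      (ComplexShape.up ℤ)).obj X).Acyclic := by
  have hex : ∀ (k l m : ℤ), l = k + 1 → m = l + 1 → ∀ (q) (y : (X.X l).obj q),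
      ((X.d l m).app q).hom y = 0 → ∃ x, ((X.d k l).app q).hom x = y := by
    rintro k l m hl rfl q y hy
    obtain rfl : k = l - 1 := by omega
    exact exists_of_exactAt (hX l) q y hy
  -- All cocycle functors are fibrant: for `k ≤ a` the source of the differential is zero, and
  -- `KerFib.succ` moves upwards from there.
  have hZ : ∀ k : ℤ, KerFib (X.d (k - 1) k) := by
    have base : ∀ k : ℤ, k ≤ a → KerFib (X.d (k - 1) k) := by
      intro k hk q f hf hf'
      have hz : ∀ r, IsZero ((X.X (k - 1)).obj r) := fun r =>
        ((evaluation Jᵒᵖ (ModuleCat.{u} R)).obj r).map_isZero (h0 (k - 1) (by omega))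
      exact ⟨0, map_zero _, fun r hr => (ModuleCat.subsingleton_of_isZero (hz _)).elim _ _⟩
    intro k
    rcases le_total k a with hk | hk
    · exact base k hk
    · induction k, hk using Int.leInduction with
      | base => exact base a le_rfl
      | succ k hk ih =>
        rw [add_sub_cancel_right]
        exact ih.succ (hF _) (hex _ _ _ (by omega) (by omega)) (X.d_comp_d _ _ _)
  intro k
  rw [HomologicalComplex.exactAt_iff' _ (k - 1) k (k + 1) (by simp) (by simp),
    ShortComplex.moduleCat_exact_iff]
  intro y hy
  have hπ : ∀ (i j : ℤ) (x : (limit (X.X i) : ModuleCat.{u} R)) (q : Jᵒᵖ),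
      (limit.π (X.X j) q).hom ((lim.map (X.d i j)).hom x) =
        ((X.d i j).app q).hom ((limit.π (X.X i) q).hom x) := fun i j x q =>
    LinearMap.congr_fun (congrArg ModuleCat.Hom.hom (limMap_π (X.d i j) q)) x
  -- A cocycle of the limit is a compatible family of cocycles; it lifts as a family along the
  -- preceding differential.
  obtain ⟨f, hf, hf'⟩ := exists_lift (hZ k) (hex _ _ (k + 1) (by omega) (by omega)) isLowerSet_univ
    (compatOn_limit_π (X.X k) Set.univ y) (fun q _ =>
      (hπ k (k + 1) y (op q)).symm.trans ((congrArg _ hy).trans (map_zero _)))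
  obtain ⟨x, hx⟩ := exists_limit_apply hf
  refine ⟨x, limit_apply_ext (fun q => ?_)⟩
  refine (hπ (k - 1) k x (op q)).trans ?_
  rw [hx]
  exact hf' q trivial

end Sections

/-! ### Higher limits through fibrant resolutions -/

section Comparison

/-- A morphism of cochain complexes is a quasi-isomorphism iff its mapping cone is acyclic. -/
lemma quasiIso_iff_acyclic_mappingCone {C : Type*} [Category* C] [Abelian C]
    {K L : CochainComplex C ℤ} (f : K ⟶ L) :
    QuasiIso f ↔ (CochainComplex.mappingCone f).Acyclic := by
  rw [← HomotopyCategory.quotient_obj_mem_subcategoryAcyclic_iff_acyclic,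
    ← HomologicalComplex.mem_quasiIso_iff, ← HomotopyCategory.quotient_map_mem_quasiIso_iff,
    HomotopyCategory.quasiIso_eq_trW_subcategoryAcyclic]
  exact (HomotopyCategory.subcategoryAcyclic C).trW_iff_of_distinguished _
    (HomotopyCategory.mappingCone_triangleh_distinguished f)

attribute [local instance] HasDerivedCategory.standard in
/-- A quasi-isomorphism to a K-injective complex extends along quasi-isomorphisms. -/
lemma exists_quasiIso_of_isKInjective {C : Type*} [Category* C] [Abelian C]
    {K L I : CochainComplex C ℤ} [I.IsKInjective] (s : K ⟶ L) (t : K ⟶ I) [QuasiIso s]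
    [QuasiIso t] : ∃ g : L ⟶ I, QuasiIso g := by
  have : IsIso (DerivedCategory.Q.map s) := by
    rwa [DerivedCategory.isIso_Q_map_iff_quasiIso]
  have : IsIso (DerivedCategory.Q.map t) := by
    rwa [DerivedCategory.isIso_Q_map_iff_quasiIso]
  let t' : DerivedCategory.Q.obj L ⟶ DerivedCategory.Q.obj I :=
    inv (DerivedCategory.Q.map s) ≫ DerivedCategory.Q.map t
  -- Because `I` is K-injective, the morphism `t'` of the derived category comes from the homotopy
  -- category, hence from a chain map.
  obtain ⟨g, hg⟩ := (CochainComplex.IsKInjective.Qh_map_bijective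
    ((HomotopyCategory.quotient _ _).obj L) I).2 t'
  obtain ⟨g, rfl⟩ := (HomotopyCategory.quotient _ _).map_surjective g
  refine ⟨g, ?_⟩
  rw [← DerivedCategory.isIso_Q_map_iff_quasiIso]
  have e : DerivedCategory.Q.map g = t' := hg
  rw [e]
  infer_instance

/-- Right derived functors in positive degrees, through the `ℤ`-indexed injective resolution. -/
lemma isZero_rightDerived_iff {C D : Type*} [Category* C] [Category* D] [Abelian C] [Abelian D]
    [HasInjectiveResolutions C] (F : C ⥤ D) [F.Additive] {X : C} (I : InjectiveResolution X)
    (k : ℕ) : IsZero ((F.rightDerived (k + 1)).obj X) ↔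
      ((F.mapHomologicalComplex (ComplexShape.up ℤ)).obj I.cochainComplex).ExactAt
        ((k + 1 : ℕ) : ℤ) := by
  rw [(I.isoRightDerivedObj F (k + 1)).isZero_iff]
  refine (HomologicalComplex.exactAt_iff_isZero_homology _ _).symm.trans ?_
  -- Since the degree `k + 1` is positive, its predecessor is still a natural number, so the `ℕ`-
  -- and `ℤ`-indexed resolutions agree in the three degrees involved.
  rw [HomologicalComplex.exactAt_iff' _ k (k + 1) (k + 2) (by simp) (by simp),
    HomologicalComplex.exactAt_iff' _ (k : ℤ) ((k + 1 : ℕ) : ℤ) ((k + 2 : ℕ) : ℤ) (by simp)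
      (by simp; omega)]
  have e : ∀ (i j : ℕ), F.map (I.cochainComplexXIso i i rfl).inv ≫ F.map (I.cochainComplex.d i j) =
      F.map (I.cocomplex.d i j) ≫ F.map (I.cochainComplexXIso j j rfl).inv := fun i j => by
    rw [I.cochainComplex_d _ _ i j rfl rfl, ← F.map_comp, ← F.map_comp, Iso.inv_hom_id_assoc]
  exact ShortComplex.exact_iff_of_iso (ShortComplex.isoMk
    (F.mapIso (I.cochainComplexXIso k k rfl).symm)
    (F.mapIso (I.cochainComplexXIso (k + 1 : ℕ) (k + 1) rfl).symm)
    (F.mapIso (I.cochainComplexXIso (k + 2 : ℕ) (k + 2) rfl).symm) (e _ _) (e _ _))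

variable {R : Type u} [CommRing R] {J : Type u} [PartialOrder J]

/-- The limit functor preserves quasi-isomorphisms between bounded below complexes of fibrant
functors. -/
theorem quasiIso_lim_map [WellFoundedLT J] {A B : CochainComplex (Jᵒᵖ ⥤ ModuleCat.{u} R) ℤ}
    (φ : A ⟶ B) [QuasiIso φ] (a : ℤ) (hA0 : ∀ k < a, IsZero (A.X k))
    (hB0 : ∀ k < a, IsZero (B.X k)) (hA : ∀ k, Fib (A.X k)) (hB : ∀ k, Fib (B.X k)) :
    QuasiIso (((lim : (Jᵒᵖ ⥤ ModuleCat.{u} R) ⥤ ModuleCat.{u} R).mapHomologicalComplex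
      (ComplexShape.up ℤ)).map φ) := by
  rw [quasiIso_iff_acyclic_mappingCone]
  have hc := (quasiIso_iff_acyclic_mappingCone φ).1 inferInstance
  -- The cone in degree `k` is `A^{k+1} ⊕ B^k`: this gives the shifted bound `a - 1`, and fibrancy
  -- from that of the two summands.
  have := acyclic_lim (CochainComplex.mappingCone φ) (a - 1) (fun k hk => by
      rw [CochainComplex.mappingCone.isZero_X_iff]
      exact ⟨hA0 _ (by omega), hB0 _ (by omega)⟩) hc (fun k =>
    Fib.of_decomp (hA (k + 1)) (hB k) _ _ _ _ (CochainComplex.mappingCone.id_X φ k (k + 1) rfl))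
  intro k
  exact (this k).of_iso (CochainComplex.mappingCone.mapHomologicalComplexIso φ lim)

/-- Higher limits are computed by resolutions by fibrant functors. -/
theorem isZero_higherLimit_iff [WellFoundedLT J] (F : Jᵒᵖ ⥤ ModuleCat.{u} R)
    (A : CochainComplex (Jᵒᵖ ⥤ ModuleCat.{u} R) ℤ)
    (s : (HomologicalComplex.single _ (ComplexShape.up ℤ) 0).obj F ⟶ A) [QuasiIso s]
    (h0 : ∀ k < 0, IsZero (A.X k)) (hA : ∀ k, Fib (A.X k)) (k : ℕ) :
    IsZero (higherLimit F (k + 1)) ↔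
      (((lim : (Jᵒᵖ ⥤ ModuleCat.{u} R) ⥤ ModuleCat.{u} R).mapHomologicalComplex
        (ComplexShape.up ℤ)).obj A).ExactAt ((k + 1 : ℕ) : ℤ) := by
  let I := injectiveResolution F
  have : QuasiIso (K := (CochainComplex.singleFunctor _ 0).obj F) s := ‹QuasiIso s›
  obtain ⟨φ, hφ⟩ := exists_quasiIso_of_isKInjective
    (K := (CochainComplex.singleFunctor _ 0).obj F) s I.ι'
  have := quasiIso_lim_map φ 0 h0 (fun k hk => I.cochainComplex.isZero_of_isStrictlyGE 0 k hk) hA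
    (fun k => Fib.of_injective _)
  exact (isZero_rightDerived_iff lim I k).trans (exactAt_iff_of_quasiIsoAt
    ((lim.mapHomologicalComplex (ComplexShape.up ℤ)).map φ) _).symm

end Comparison

/-! ### Cocylinders and chosen factorisations: quasi-isomorphism, surjectivity, height -/

section Cocylinder

variable {R : Type u} [CommRing R] {C D : CochainComplex (ModuleCat.{u} R) ℤ}

/-- The projection `(c, x, y) ↦ c` of the mapping cocylinder. -/
def cocylFst (f : C ⟶ D) : cocyl f ⟶ C where
  f k := ModuleCat.ofHom (LinearMap.fst R (C.X k) (D.X (k - 1) × D.X k))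
  comm' i j hij := by
    simp only [ComplexShape.up_Rel] at hij
    rw [cocyl_d f (by omega)]
    rfl

/-- The contracting homotopy `(c, x, y) ↦ (0, 0, x)` of the mapping cocylinder onto its source, from
degree `i` to degree `j = i - 1`. -/
def cocylH (f : C ⟶ D) (i j : ℤ) (h : i - 1 = j) :
    (C.X i × D.X (i - 1) × D.X i) →ₗ[R] (C.X j × D.X (j - 1) × D.X j) :=
  (LinearMap.inr R (C.X j) (D.X (j - 1) × D.X j)).comp
    ((LinearMap.inr R (D.X (j - 1)) (D.X j)).comp ((D.XIsoOfEq h).hom.hom.comp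
      ((LinearMap.fst R (D.X (i - 1)) (D.X i)).comp
        (LinearMap.snd R (C.X i) (D.X (i - 1) × D.X i)))))

/-- With `H(c, x, y) = (0, 0, x)` one has `H∂ = (0, 0, y - f(c) - ∂x)` and `∂H = (0, x, ∂x)`.
Subtracting both from the identity leaves `(c, 0, f(c))`, so `-H` is the homotopy. -/
lemma cocylH_comm (f : C ⟶ D) (i j k : ℤ) (h : i = j - 1) (h' : j = k - 1)
    (x : C.X j × D.X (j - 1) × D.X j) :
    ((x.1, 0, (f.f j).hom x.1) : C.X j × D.X (j - 1) × D.X j) =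
      -cocylH f k j h'.symm (cocylD f j k h' x) + cocylD f i j h (-cocylH f j i h.symm x) + x := by
  subst h'
  subst h
  obtain ⟨c, y, z⟩ := x
  refine Prod.ext ?_ (Prod.ext ?_ ?_)
  · simp [cocylD, cocylH]
  · simp [cocylD, cocylH]
  · simp [cocylD, cocylH]
    abel

/-- The components of the contracting homotopy of the mapping cocylinder onto its source. -/
def cocylHom (f : C ⟶ D) (i j : ℤ) : (cocyl f).X i ⟶ (cocyl f).X j :=
  if h : i - 1 = j then ModuleCat.ofHom (-cocylH f i j h) else 0

lemma cocylHom_eq (f : C ⟶ D) {i j : ℤ} (h : i - 1 = j) :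
    cocylHom f i j = ModuleCat.ofHom (-cocylH f i j h) :=
  dif_pos h

/-- The mapping cocylinder is homotopy equivalent to its source. -/
def cocylHomotopyEquiv (f : C ⟶ D) : HomotopyEquiv C (cocyl f) where
  hom := (cocylFactorisation f).ι
  inv := cocylFst f
  homotopyHomInvId := Homotopy.ofEq rfl
  homotopyInvHomId :=
    { hom := cocylHom f
      zero := fun i j hij => dif_neg (fun h => hij (by
        simp only [ComplexShape.up_Rel]
        omega))
      comm := fun i => by
        have e₁ : dNext i (cocylHom f) = (cocyl f).d i (i + 1) ≫ cocylHom f (i + 1) i :=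
          dNext_eq _ rfl
        have e₂ : prevD i (cocylHom f) = cocylHom f i (i - 1) ≫ (cocyl f).d (i - 1) i :=
          prevD_eq _ (by simp)
        rw [cocyl_d f (show i = i + 1 - 1 by omega), cocylHom_eq f (by omega)] at e₁
        rw [cocyl_d f rfl, cocylHom_eq f rfl] at e₂
        refine Eq.trans ?_ (congrArg₂ (fun a b => a + b + 𝟙 _) e₁ e₂).symm
        refine ModuleCat.hom_ext (LinearMap.ext fun x => ?_)
        exact cocylH_comm f (i - 1) i (i + 1) rfl (by omega) x }

instance quasiIso_cocyl (f : C ⟶ D) : QuasiIso (cocylFactorisation f).ι :=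
  (cocylHomotopyEquiv f).quasiIso_hom

lemma chosenFactorisation_of_pos {lf : Prop} (h : lf) (f : C ⟶ D) :
    chosenFactorisation lf f = trivialFactorisation f :=
  if_pos h

/-- A case analysis that hides the choice of the integer in `Truncatable`. The truncation index is
`m - 1` because the top degree `m` is discarded. -/
lemma chosenFactorisation_of_neg {lf : Prop} (h : ¬ lf) (f : C ⟶ D) :
    (∃ (m : ℤ) (hC : _), height D = ((m : WithTop ℤ) : WithBot (WithTop ℤ)) ∧
      Epi (D.d (m - 1) m) ∧ chosenFactorisation lf f = truncCocylFactorisation f (m - 1) hC) ∨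
    (¬ Truncatable f ∧ chosenFactorisation lf f = cocylFactorisation f) := by
  by_cases h' : Truncatable f
  · exact Or.inl ⟨h'.2.choose, _, h'.2.choose_spec.1, h'.2.choose_spec.2,
      (if_neg h).trans (dif_pos h')⟩
  · exact Or.inr ⟨h', (if_neg h).trans (dif_neg h')⟩

instance quasiIso_chosenFactorisation (lf : Prop) (f : C ⟶ D) :
    QuasiIso (chosenFactorisation lf f).ι := by
  by_cases h : lf
  · rw [chosenFactorisation_of_pos h]
    exact (inferInstance : QuasiIso (𝟙 C))
  · obtain ⟨m, hC, -, -, e⟩ | ⟨-, e⟩ := chosenFactorisation_of_neg h f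
    · rw [e]
      exact quasiIso_cocyl (truncMap f _)
    · rw [e]
      exact quasiIso_cocyl f

lemma isZero_cocyl {f : C ⟶ D} {k : ℤ} (hC : IsZero (C.X k)) (hD : IsZero (D.X (k - 1)))
    (hD' : IsZero (D.X k)) : IsZero ((cocyl f).X k) := by
  have := ModuleCat.subsingleton_of_isZero hC
  have := ModuleCat.subsingleton_of_isZero hD
  have := ModuleCat.subsingleton_of_isZero hD'
  exact ModuleCat.isZero_of_iff_subsingleton.2
    (inferInstance : Subsingleton (C.X k × D.X (k - 1) × D.X k))

lemma isZero_trunc {k : ℤ} (hD : IsZero (D.X k)) (n : ℤ) : IsZero ((trunc D n).X k) := by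
  have := ModuleCat.subsingleton_of_isZero hD
  exact ModuleCat.isZero_of_iff_subsingleton.2 (inferInstance : Subsingleton (truncX D n k))

lemma isZero_trunc_of_lt {k n : ℤ} (h : n < k) : IsZero ((trunc D n).X k) :=
  ModuleCat.isZero_of_iff_subsingleton.2
    (⟨fun x y => (truncX_eq_zero h x).trans (truncX_eq_zero h y).symm⟩ :
      Subsingleton (truncX D n k))

lemma isZero_chosenFactorisation {lf : Prop} {f : C ⟶ D} {k : ℤ} (hC : IsZero (C.X k))
    (hD : IsZero (D.X (k - 1))) (hD' : IsZero (D.X k)) :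
    IsZero ((chosenFactorisation lf f).mid.X k) := by
  by_cases h : lf
  · rw [chosenFactorisation_of_pos h]
    exact hC
  · obtain ⟨m, _, -, -, e⟩ | ⟨-, e⟩ := chosenFactorisation_of_neg h f
    · rw [e]
      exact isZero_cocyl hC (isZero_trunc hD _) (isZero_trunc hD' _)
    · rw [e]
      exact isZero_cocyl hC hD hD'

lemma height_le_iff {n : ℤ} : height C ≤ ((n : WithTop ℤ) : WithBot (WithTop ℤ)) ↔
    ∀ k, n < k → IsZero (C.X k) := by
  rw [height, iSup₂_le_iff]
  refine forall_congr' fun k => ?_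
  rw [WithBot.coe_le_coe, WithTop.coe_le_coe, ← not_lt]
  exact not_imp_not

lemma height_eq {n : ℤ} (h : ∀ k, n < k → IsZero (C.X k)) (hn : ¬ IsZero (C.X n)) :
    height C = ((n : WithTop ℤ) : WithBot (WithTop ℤ)) :=
  le_antisymm (height_le_iff.2 h) (le_iSup₂_of_le (f := fun (k : ℤ) (_ : ¬ IsZero (C.X k)) =>
    ((k : WithTop ℤ) : WithBot (WithTop ℤ))) n hn le_rfl)

/-- Below degree `m` the last coordinate covers `D`. In degree `m` that coordinate is lost, but `x ↦
∂x` is onto by truncatability. Above `m` the target is zero. -/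
lemma epi_truncCocylFactorisation {f : C ⟶ D} {m : ℤ} (hC)
    (hD : height D = ((m : WithTop ℤ) : WithBot (WithTop ℤ))) (he : Epi (D.d (m - 1) m)) (k : ℤ) :
    Epi ((truncCocylFactorisation f (m - 1) hC).π.f k) := by
  rw [ModuleCat.epi_iff_surjective]
  change Function.Surjective (truncCocylProj C D (m - 1) k)
  intro y
  rcases lt_trichotomy k m with h | rfl | h
  · refine ⟨(0, 0, ⟨y, fun h' => absurd h' (by omega)⟩), ?_⟩
    rw [truncCocylProj_of_le (by omega)]
  · obtain ⟨x, hx⟩ := (ModuleCat.epi_iff_surjective _).1 he y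
    refine ⟨(0, ⟨x, fun h' => absurd h' (by omega)⟩, 0), ?_⟩
    rw [truncCocylProj_of_eq (by omega)]
    exact hx
  · exact ⟨0, (ModuleCat.subsingleton_of_isZero (height_le_iff.1 hD.le k h)).elim _ _⟩

lemma epi_cocylFactorisation (f : C ⟶ D) (k : ℤ) : Epi ((cocylFactorisation f).π.f k) := by
  rw [ModuleCat.epi_iff_surjective]
  exact fun y => ⟨((0, 0, y) : C.X k × D.X (k - 1) × D.X k), rfl⟩

lemma epi_chosenFactorisation {lf : Prop} {f : C ⟶ D} {k : ℤ} (h : lf → Epi (f.f k)) :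
    Epi ((chosenFactorisation lf f).π.f k) := by
  by_cases hlf : lf
  · rw [chosenFactorisation_of_pos hlf]
    exact h hlf
  · obtain ⟨m, _, hm, he, e⟩ | ⟨-, e⟩ := chosenFactorisation_of_neg hlf f
    · rw [e]
      exact epi_truncCocylFactorisation _ hm he k
    · rw [e]
      exact epi_cocylFactorisation f k

/-- The chosen factorisation does not exceed height `n` if the target has no cohomology in degree
`n`. -/
lemma height_chosenFactorisation_le {lf : Prop} {f : C ⟶ D} {n : ℤ}
    (hC : ∀ k, n ≤ k → IsZero (C.X k)) (hD : ∀ k, n < k → IsZero (D.X k))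
    (he : Epi (D.d (n - 1) n)) (k : ℤ) (hk : n < k) :
    IsZero ((chosenFactorisation lf f).mid.X k) := by
  -- The cocylinder in degree `k` also contains `D^{k-1}`, so the only critical degree is `n + 1`,
  -- where `D^n` enters.
  obtain hk' | rfl : n < k - 1 ∨ k = n + 1 := by omega
  · exact isZero_chosenFactorisation (hC k hk.le) (hD _ hk') (hD k hk)
  by_cases hlf : lf
  · rw [chosenFactorisation_of_pos hlf]
    exact hC _ hk.le
  obtain ⟨m, _, hm, -, e⟩ | ⟨ht, e⟩ := chosenFactorisation_of_neg hlf f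
  · rw [e]
    refine isZero_cocyl (hC _ hk.le) (isZero_trunc_of_lt ?_) (isZero_trunc (hD _ hk) _)
    -- As `m ≤ n`, truncation above degree `m - 1` kills degree `n`.
    have := hm.symm.trans_le (height_le_iff.2 hD)
    rw [WithBot.coe_le_coe, WithTop.coe_le_coe] at this
    omega
  · rw [e]
    refine isZero_cocyl (hC _ hk.le) ?_ (hD _ hk)
    rw [add_sub_cancel_right]
    -- If `D^n` were nonzero, `D` would have height exactly `n` while `C` lives below `n`; with
    -- `he`, the map would be truncatable after all.
    by_contra hn
    have hh := height_eq hD hn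
    refine ht ⟨?_, n, hh, he⟩
    rw [hh]
    refine (height_le_iff (n := n - 1).2 fun k hk => hC k (by omega)).trans_lt ?_
    rw [WithBot.coe_lt_coe, WithTop.coe_lt_coe]
    omega

/-- If a nontrivial chosen factorisation does not exceed height `n`, then the target has no
cohomology in degree `n`. -/
lemma epi_of_isZero_chosenFactorisation {f : C ⟶ D} {n : ℤ}
    (hD : ∀ k, n < k → IsZero (D.X k)) {lf : Prop} (hlf : ¬ lf)
    (h : IsZero ((chosenFactorisation lf f).mid.X (n + 1))) : Epi (D.d (n - 1) n) := by
  obtain ⟨m, _, hm, he, -⟩ | ⟨-, e⟩ := chosenFactorisation_of_neg hlf f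
  · have hmn := hm.symm.trans_le (height_le_iff.2 hD)
    rw [WithBot.coe_le_coe, WithTop.coe_le_coe] at hmn
    -- For `m = n` surjectivity is part of truncatability; for `m < n` the target `D^n` is zero.
    rcases hmn.eq_or_lt with rfl | hmn
    · exact he
    · exact (height_le_iff.1 hm.le n hmn).epi _
  · rw [e] at h
    have h' : Subsingleton (C.X (n + 1) × D.X (n + 1 - 1) × D.X (n + 1)) :=
      ModuleCat.subsingleton_of_isZero h
    -- `D^n` is the middle factor of the untruncated cocylinder in degree `n + 1`.
    have hz : IsZero (D.X (n + 1 - 1)) := ModuleCat.isZero_of_iff_subsingleton.2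
      ⟨fun x y => congrArg (fun t => t.2.1) (h'.elim (0, x, 0) (0, y, 0))⟩
    rw [add_sub_cancel_right] at hz
    exact hz.epi _

end Cocylinder

/-! ### Functoriality of matching maps -/

section Matching

variable {P : Type u} [PartialOrder P] {V : Type (u + 1)} [Category.{u} V]
  [HasLimitsOfSize.{u, u} V]

/-- The morphism between limits over `P_{<p}` induced by a natural transformation. -/
def limBelowMap {K K' : Pᵒᵖ ⥤ V} (α : K ⟶ K') (p : P) :
    limit (restrictBelow K p) ⟶ limit (restrictBelow K' p) :=
  limMap (Functor.whiskerLeft (belowInclusion p).op α)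

lemma limBelowMap_proj {K K' : Pᵒᵖ ⥤ V} (α : K ⟶ K') {p q : P} (h : q < p) :
    limBelowMap α p ≫ projBelow K' h = projBelow K h ≫ α.app (op q) :=
  limMap_π _ _

lemma limBelow_hom_ext {K : Pᵒᵖ ⥤ V} {p : P} {X : V} {f g : X ⟶ limit (restrictBelow K p)}
    (H : ∀ (q : P) (h : q < p), f ≫ projBelow K h = g ≫ projBelow K h) : f = g :=
  limit.hom_ext fun q => H q.unop.1 q.unop.2

lemma isIso_limBelowMap {K K' : Pᵒᵖ ⥤ V} (α : K ⟶ K') (p : P)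
    (h : ∀ q < p, IsIso (α.app (op q))) : IsIso (limBelowMap α p) := by
  have : ∀ q, IsIso ((Functor.whiskerLeft (belowInclusion p).op α).app q) :=
    fun q => h q.unop.1 q.unop.2
  have := NatIso.isIso_of_isIso_app (Functor.whiskerLeft (belowInclusion p).op α)
  exact (lim.mapIso (asIso (Functor.whiskerLeft (belowInclusion p).op α))).isIso_hom

lemma matchingMap_naturality {K K' : Pᵒᵖ ⥤ V} (α : K ⟶ K') (p : P) :
    matchingMap K p ≫ limBelowMap α p = α.app (op p) ≫ matchingMap K' p := by
  refine limBelow_hom_ext fun q h => ?_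
  rw [Category.assoc, Category.assoc, limBelowMap_proj, matchingMap_proj, ← Category.assoc,
    matchingMap_proj, α.naturality]

/-- Restriction maps of `step` from `p` to smaller elements pass through `(fac p).π` by
construction. When nothing below `p` changes, the second factor is invertible and surjectivity
depends on `π` alone. -/
lemma matchingMap_step (K : Pᵒᵖ ⥤ V) (fac : ∀ p, Factorisation (matchingMap K p)) (p : P) :
    matchingMap (step K fac) p = (fac p).π ≫ limBelowMap (stepι K fac) p := by
  refine limBelow_hom_ext fun q h => ?_
  refine (matchingMap_proj _ h).trans (Eq.trans ?_ ((congrArg ((fac p).π ≫ ·)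
    (limBelowMap_proj (stepι K fac) h)).symm.trans (Category.assoc _ _ _).symm))
  exact dif_neg h.ne'

lemma matchingMap_comp {W : Type (u + 1)} [Category.{u} W] [HasLimitsOfSize.{u, u} W]
    (K : Pᵒᵖ ⥤ V) (G : V ⥤ W) (p : P) [PreservesLimitsOfShape (Set.Iio p)ᵒᵖ G] :
    matchingMap (K ⋙ G) p =
      G.map (matchingMap K p) ≫ (preservesLimitIso G (restrictBelow K p)).hom := by
  refine limBelow_hom_ext fun q h => ?_
  have e : (preservesLimitIso G (restrictBelow K p)).hom ≫ projBelow (K ⋙ G) h =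
      G.map (projBelow K h) := preservesLimitIso_hom_π G (restrictBelow K p) _
  refine (matchingMap_proj _ h).trans (Eq.trans ?_ ((congrArg (G.map (matchingMap K p) ≫ ·)
    e).symm.trans (Category.assoc _ _ _).symm))
  rw [← G.map_comp, matchingMap_proj]
  rfl

/-- The matching map at `p` only sees the functor on `P_{≤p}`. -/
lemma epi_matchingMap_iff_of_natTrans {K K' : Pᵒᵖ ⥤ V} (α : K ⟶ K') (p : P)
    (h : ∀ q ≤ p, IsIso (α.app (op q))) : Epi (matchingMap K p) ↔ Epi (matchingMap K' p) := by
  have := isIso_limBelowMap α p (fun q hq => h q hq.le)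
  have := h p le_rfl
  have e := matchingMap_naturality α p
  constructor
  · intro he
    have : Epi (α.app (op p) ≫ matchingMap K' p) := by rw [← e]; infer_instance
    exact epi_of_epi (α.app (op p)) _
  · intro he
    rw [← epi_comp_iff_of_isIso _ (limBelowMap α p), e]
    infer_instance

end Matching

/-! ### Functors to complexes as complexes of functors -/

section Complexes

variable {R : Type u} [CommRing R] {P : Type u} [PartialOrder P]

/-- Evaluation of a functor to cochain complexes at degree `k`. -/
abbrev evalAt {J : Type u} [PartialOrder J] (K : Jᵒᵖ ⥤ CochainComplex (ModuleCat.{u} R) ℤ) (k : ℤ) :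
    Jᵒᵖ ⥤ ModuleCat.{u} R :=
  K ⋙ HomologicalComplex.eval (ModuleCat.{u} R) (ComplexShape.up ℤ) k

lemma epi_matchingMap_evalAt (K : Pᵒᵖ ⥤ CochainComplex (ModuleCat.{u} R) ℤ) (k : ℤ) (p : P) :
    Epi (matchingMap (evalAt K k) p) ↔ Epi ((matchingMap K p).f k) := by
  rw [matchingMap_comp]
  let G := HomologicalComplex.eval (ModuleCat.{u} R) (ComplexShape.up ℤ) k
  let i := preservesLimitIso G (restrictBelow K p)
  have : IsIso i.hom := i.isIso_hom
  exact epi_comp_iff_of_isIso (G.map (matchingMap K p)) i.hom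

lemma isZero_limit {J : Type u} [PartialOrder J] {G : Jᵒᵖ ⥤ ModuleCat.{u} R}
    (h : ∀ q, IsZero (G.obj q)) : IsZero (limit G) :=
  ModuleCat.isZero_of_iff_subsingleton.2 ⟨fun _ _ => limit_apply_ext fun q =>
    (ModuleCat.subsingleton_of_isZero (h (op q))).elim _ _⟩

lemma isZero_limit_X {J : Type u} [PartialOrder J] {K : Jᵒᵖ ⥤ CochainComplex (ModuleCat.{u} R) ℤ}
    {k : ℤ} (h : ∀ q, IsZero ((K.obj q).X k)) : IsZero ((limit K).X k) :=
  (isZero_limit (G := evalAt K k) h).of_iso (preservesLimitIso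
    (HomologicalComplex.eval (ModuleCat.{u} R) (ComplexShape.up ℤ) k) K)

/-- The complex of functors associated with a functor to complexes. -/
def toComplex {J : Type u} [PartialOrder J] (K : Jᵒᵖ ⥤ CochainComplex (ModuleCat.{u} R) ℤ) :
    CochainComplex (Jᵒᵖ ⥤ ModuleCat.{u} R) ℤ where
  X k := evalAt K k
  d i j :=
    { app := fun q => (K.obj q).d i j
      naturality := fun _ _ f => ((K.map f).comm i j) }
  shape i j h := by
    ext1
    funext q
    exact (K.obj q).shape i j h
  d_comp_d' i j k _ _ := by
    ext1
    funext q
    exact (K.obj q).d_comp_d i j k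

/-- The limit of a functor to complexes is the complex of limits. -/
def limToComplexIso {J : Type u} [PartialOrder J]
    (K : Jᵒᵖ ⥤ CochainComplex (ModuleCat.{u} R) ℤ) :
    limit K ≅ ((lim : (Jᵒᵖ ⥤ ModuleCat.{u} R) ⥤ ModuleCat.{u} R).mapHomologicalComplex
      (ComplexShape.up ℤ)).obj (toComplex K) :=
  HomologicalComplex.Hom.isoOfComponents (fun k => preservesLimitIso
    (HomologicalComplex.eval (ModuleCat.{u} R) (ComplexShape.up ℤ) k) K) (fun i j _ => by
      refine limit.hom_ext (F := evalAt K j) fun q => ?_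
      have e : ∀ k, (preservesLimitIso (HomologicalComplex.eval (ModuleCat.{u} R)
          (ComplexShape.up ℤ) k) K).hom ≫ limit.π (evalAt K k) q = (limit.π K q).f k :=
        fun k => preservesLimitIso_hom_π _ K q
      have e' : lim.map ((toComplex K).d i j) ≫ limit.π (evalAt K j) q =
        limit.π (evalAt K i) q ≫ (K.obj q).d i j := limMap_π _ _
      refine (Category.assoc _ _ _).trans ((congrArg _ e').trans ?_)
      refine (Category.assoc _ _ _).symm.trans ((congrArg (· ≫ _) (e i)).trans ?_)
      refine ((limit.π K q).comm i j).trans ?_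
      exact (congrArg _ (e j).symm).trans (Category.assoc _ _ _).symm)

/-- The morphism to the complex of functors induced by a morphism to a functor to complexes. -/
def singleToComplex {J : Type u} [PartialOrder J] {F : Jᵒᵖ ⥤ ModuleCat.{u} R}
    {K : Jᵒᵖ ⥤ CochainComplex (ModuleCat.{u} R) ℤ}
    (α : F ⋙ HomologicalComplex.single (ModuleCat.{u} R) (ComplexShape.up ℤ) 0 ⟶ K) :
    (HomologicalComplex.single _ (ComplexShape.up ℤ) 0).obj F ⟶ toComplex K :=
  HomologicalComplex.mkHomFromSingle
    { app := fun q => (HomologicalComplex.singleObjXSelf (ComplexShape.up ℤ) 0 (F.obj q)).inv ≫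
        (α.app q).f 0
      naturality := fun a b f => by
        have e := congrArg (fun g => g.f 0) (α.naturality f)
        have e' : F.map f ≫ (HomologicalComplex.singleObjXSelf (ComplexShape.up ℤ) 0 _).inv =
          (HomologicalComplex.singleObjXSelf (ComplexShape.up ℤ) 0 _).inv ≫
            ((HomologicalComplex.single (ModuleCat.{u} R) (ComplexShape.up ℤ) 0).map
              (F.map f)).f 0 := by
          rw [HomologicalComplex.single_map_f_self, Iso.inv_hom_id_assoc]
        refine (Category.assoc _ _ _).symm.trans ((congrArg (· ≫ _) e').trans ?_)
        exact (Category.assoc _ _ _).trans ((congrArg _ e).trans (Category.assoc _ _ _).symm) }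
    (fun i _ => by
      ext1
      funext q
      refine (Category.assoc _ _ _).trans ?_
      have e : (α.app q).f 0 ≫ (K.obj q).d 0 i = 0 := by
        refine ((α.app q).comm 0 i).trans ?_
        refine (congrArg (· ≫ _) (HomologicalComplex.single_obj_d _ _ _ _ _)).trans zero_comp
      exact (congrArg _ e).trans comp_zero)

/-- Quasi-isomorphisms of complexes of functors are detected objectwise, and at `q` the morphism is
`α.app q` up to the identification of an evaluated single complex with a single complex. -/
lemma quasiIso_singleToComplex {J : Type u} [PartialOrder J] {F : Jᵒᵖ ⥤ ModuleCat.{u} R}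
    {K : Jᵒᵖ ⥤ CochainComplex (ModuleCat.{u} R) ℤ}
    (α : F ⋙ HomologicalComplex.single (ModuleCat.{u} R) (ComplexShape.up ℤ) 0 ⟶ K)
    (h : ∀ q, QuasiIso (α.app q)) : QuasiIso (singleToComplex α) := by
  rw [HomologicalComplex.quasiIso_iff_evaluation]
  intro q
  have := h q
  let e := (HomologicalComplex.singleMapHomologicalComplex
    ((evaluation Jᵒᵖ (ModuleCat.{u} R)).obj q) (ComplexShape.up ℤ) 0).app F
  have key : e.inv ≫ (((evaluation Jᵒᵖ (ModuleCat.{u} R)).obj q).mapHomologicalComplex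
      (ComplexShape.up ℤ)).map (singleToComplex α) = α.app q := by
    refine HomologicalComplex.from_single_hom_ext ?_
    have e₁ : e.inv.f 0 = (HomologicalComplex.singleObjXSelf (ComplexShape.up ℤ) 0
        (F.obj q)).hom ≫ (HomologicalComplex.singleObjXSelf (ComplexShape.up ℤ) 0 F).inv.app q :=
      HomologicalComplex.singleMapHomologicalComplex_inv_app_self _ _ _ _
    have e₂ : ((singleToComplex α).f 0).app q =
        (HomologicalComplex.singleObjXSelf (ComplexShape.up ℤ) 0 F).hom.app q ≫
          (HomologicalComplex.singleObjXSelf (ComplexShape.up ℤ) 0 (F.obj q)).inv ≫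
            (α.app q).f 0 :=
      NatTrans.congr_app (HomologicalComplex.mkHomFromSingle_f _ _) q
    have e₃ : (HomologicalComplex.singleObjXSelf (ComplexShape.up ℤ) 0 F).inv.app q ≫
        (HomologicalComplex.singleObjXSelf (ComplexShape.up ℤ) 0 F).hom.app q = 𝟙 (F.obj q) :=
      NatTrans.congr_app (HomologicalComplex.singleObjXSelf (ComplexShape.up ℤ) 0 F).inv_hom_id q
    refine (congrArg₂ (· ≫ ·) e₁ e₂).trans ?_
    refine (Category.assoc _ _ _).trans ?_
    refine (congrArg (_ ≫ ·) ((Category.assoc _ _ _).symm.trans (congrArg (· ≫ _) e₃))).trans ?_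
    refine (congrArg (_ ≫ ·) (Category.id_comp _)).trans ?_
    exact Iso.hom_inv_id_assoc _ _
  have : QuasiIso (e.inv ≫ (((evaluation Jᵒᵖ (ModuleCat.{u} R)).obj q).mapHomologicalComplex
      (ComplexShape.up ℤ)).map (singleToComplex α)) := by rw [key]; exact h q
  exact (quasiIso_iff_comp_left e.inv _).1 this

end Complexes

/-! ### The stages form a fibrant resolution -/

section Stages

variable {R : Type u} [CommRing R] {P : Type u} [PartialOrder P]

/-- For `q < p`, the elements below `q` are the same in `P_{<p}` as in `P`. -/
lemma Fib.restrictBelow {G : Pᵒᵖ ⥤ ModuleCat.{u} R} {p : P}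
    (h : ∀ q < p, Epi (matchingMap G q)) : Fib (restrictBelow G p) := by
  intro q f hf
  obtain ⟨g, hg⟩ : ∃ g : ∀ r, r < p → G.obj (op r), ∀ r h, g r h = f ⟨r, h⟩ :=
    ⟨_, fun _ _ => rfl⟩
  obtain ⟨x, hx⟩ := (epi_matchingMap_iff G q.1).1 (h q.1 q.2) (extendBelow G p g) (by
    intro s hs r hr
    have hs' : s < p := lt_trans hs q.2
    rw [extendBelow_of_lt _ _ hs', extendBelow_of_lt _ _ (hr.trans hs'), hg, hg]
    exact hf ⟨s, hs'⟩ hs ⟨r, hr.trans hs'⟩ hr)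
  exact ⟨x, fun r hr => (hx r.1 hr).trans ((extendBelow_of_lt _ _ r.2).trans (hg _ _))⟩

lemma isZero_X_of_isIso {C D : CochainComplex (ModuleCat.{u} R) ℤ} (f : C ⟶ D) (hf : IsIso f)
    (k : ℤ) : IsZero (C.X k) ↔ IsZero (D.X k) :=
  (asIso (f.f k)).isZero_iff

variable (d : P → ℕ) (F : Pᵒᵖ ⥤ ModuleCat.{u} R)

/-- The factorisations used in the construction of the stages. -/
def stageFac (n : ℕ) (p : P) : Factorisation (matchingMap (stage d F n) p) :=
  if d p = n then chosenFactorisation (LocallyFibrant F p) (matchingMap (stage d F n) p)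
  else trivialFactorisation (matchingMap (stage d F n) p)

lemma stageFac_of_eq {n : ℕ} {p : P} (h : d p = n) : stageFac d F n p =
    chosenFactorisation (LocallyFibrant F p) (matchingMap (stage d F n) p) :=
  if_pos h

lemma stageFac_of_ne {n : ℕ} {p : P} (h : d p ≠ n) : stageFac d F n p =
    trivialFactorisation (matchingMap (stage d F n) p) :=
  if_neg h

lemma stageMap_succ_app (n : ℕ) (p : P) :
    (stageMap d F (Nat.zero_le (n + 1))).app (op p) =
      (stageMap d F (Nat.zero_le n)).app (op p) ≫ (stageFac d F n p).ι := by
  rw [stageMap_trans d F (Nat.zero_le n) n.le_succ, stageMap_succ]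
  rfl

lemma isIso_stageFac_of_ne {n : ℕ} {p : P} (h : d p ≠ n) : IsIso (stageFac d F n p).ι := by
  rw [stageFac_of_ne d F h]
  exact IsIso.id _

lemma isIso_stageFac_of_locallyFibrant (n : ℕ) {p : P} (h : LocallyFibrant F p) :
    IsIso (stageFac d F n p).ι := by
  by_cases hp : d p = n
  · rw [stageFac_of_eq d F hp, chosenFactorisation_of_pos h]
    exact IsIso.id _
  · exact isIso_stageFac_of_ne d F hp

lemma quasiIso_stageFac (n : ℕ) (p : P) : QuasiIso (stageFac d F n p).ι := by
  by_cases hp : d p = n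
  · rw [stageFac_of_eq d F hp]
    infer_instance
  · have := isIso_stageFac_of_ne d F hp
    infer_instance

/-- The value at `p` is first modified in passing from stage `d p` to stage `d p + 1`. -/
lemma isIso_stageMap_of_le {m : ℕ} {p : P} (h : m ≤ d p) :
    IsIso ((stageMap d F (Nat.zero_le m)).app (op p)) := by
  induction m with
  | zero =>
    rw [stageMap_refl]
    exact IsIso.id _
  | succ m ih =>
    rw [stageMap_succ_app]
    exact IsIso.comp_isIso' (ih (by omega)) (isIso_stageFac_of_ne d F (by omega))

/-- At a locally fibrant `p` every factorisation used is trivial, so all stages keep `F(p)` in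
degree `0`. -/
lemma isIso_stageMap_of_locallyFibrant (m : ℕ) {p : P} (h : LocallyFibrant F p) :
    IsIso ((stageMap d F (Nat.zero_le m)).app (op p)) := by
  induction m with
  | zero =>
    rw [stageMap_refl]
    exact IsIso.id _
  | succ m ih =>
    rw [stageMap_succ_app]
    exact IsIso.comp_isIso' ih (isIso_stageFac_of_locallyFibrant d F m h)

lemma quasiIso_stageMap (m : ℕ) (p : P) :
    QuasiIso ((stageMap d F (Nat.zero_le m)).app (op p)) := by
  induction m with
  | zero =>
    rw [stageMap_refl]
    exact (inferInstance : QuasiIso (𝟙 ((stage d F 0).obj (op p))))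
  | succ m ih =>
    have := quasiIso_stageFac d F m p
    rw [stageMap_succ_app]
    exact quasiIso_comp ((stageMap d F (Nat.zero_le m)).app (op p)) (stageFac d F m p).ι

lemma isZero_stage_zero (p : Pᵒᵖ) {k : ℤ} (hk : k ≠ 0) : IsZero (((stage d F 0).obj p).X k) :=
  HomologicalComplex.isZero_single_obj_X _ _ _ _ hk

lemma isZero_stage_neg (m : ℕ) (p : P) {k : ℤ} (hk : k < 0) :
    IsZero (((stage d F m).obj (op p)).X k) := by
  induction m generalizing p k with
  | zero => exact isZero_stage_zero d F (op p) hk.ne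
  | succ m ih =>
    change IsZero ((stageFac d F m p).mid.X k)
    by_cases hp : d p = m
    · rw [stageFac_of_eq d F hp]
      exact isZero_chosenFactorisation (ih p hk) (isZero_limit_X fun q => ih q.unop.1 (by omega))
        (isZero_limit_X fun q => ih q.unop.1 hk)
    · rw [stageFac_of_ne d F hp]
      exact ih p hk

lemma epi_matchingMap_stage_zero {p : P} (h : Epi (matchingMap F p)) (k : ℤ) :
    Epi ((matchingMap (stage d F 0) p).f k) := by
  by_cases hk : k = 0
  · subst hk
    rw [← epi_matchingMap_evalAt]
    let e : F ⟶ evalAt (stage d F 0) 0 := Functor.whiskerLeft F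
      (HomologicalComplex.singleCompEvalIsoSelf (ModuleCat.{u} R) (ComplexShape.up ℤ) 0).inv
    refine (epi_matchingMap_iff_of_natTrans e p fun q _ => ?_).1 h
    exact inferInstanceAs (IsIso ((HomologicalComplex.singleCompEvalIsoSelf (ModuleCat.{u} R)
      (ComplexShape.up ℤ) 0).inv.app (F.obj (op q))))
  · exact (isZero_limit_X (K := restrictBelow (stage d F 0) p)
      fun q => isZero_stage_zero d F _ hk).epi _

/-- The matching maps of the stages are degreewise epimorphisms where the construction is
completed. -/
lemma epi_matchingMap_stage (hd : StrictMono d) {m : ℕ} {p : P} (h : d p < m) (k : ℤ) :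
    Epi ((matchingMap (stage d F m) p).f k) := by
  induction m with
  | zero => omega
  | succ m ih =>
    -- Any `q < p` has `d q < d p ≤ m`, so this step does not alter values below `p`.
    have hi : IsIso (limBelowMap (stepι (stage d F m) (stageFac d F m)) p) :=
      isIso_limBelowMap _ p fun q hq => by
        have := hd hq
        have h' := isIso_stageMap_succ d F m q (by omega)
        rwa [stageMap_succ] at h'
    have he : Epi ((stageFac d F m p).π.f k) := by
      by_cases hp : d p = m
      · rw [stageFac_of_eq d F hp]
        -- Only the trivial factorisation needs an argument. Local fibrancy is inherited by all `q ≤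
        -- p`, so the stage still agrees with `F` on `P_{≤p}`, and the matching map of `F` is
        -- surjective by hypothesis.
        refine epi_chosenFactorisation fun hlf => ?_
        have h0 := epi_matchingMap_stage_zero d F (hlf p le_rfl) k
        rw [← epi_matchingMap_evalAt] at h0 ⊢
        refine (epi_matchingMap_iff_of_natTrans (Functor.whiskerRight
          (stageMap d F (Nat.zero_le m)) (HomologicalComplex.eval (ModuleCat.{u} R)
            (ComplexShape.up ℤ) k)) p fun q hq => ?_).1 h0
        have := isIso_stageMap_of_locallyFibrant d F m
          (show LocallyFibrant F q from fun r hr => hlf r (hr.trans hq))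
        exact inferInstanceAs (IsIso (((stageMap d F (Nat.zero_le m)).app (op q)).f k))
      · rw [stageFac_of_ne d F hp]
        exact ih (by omega)
    have e : matchingMap (stage d F (m + 1)) p = _ := matchingMap_step _ _ p
    rw [e]
    exact epi_comp' he (inferInstanceAs (Epi ((limBelowMap
      (stepι (stage d F m) (stageFac d F m)) p).f k)))

/-! ### Higher limits against the height of the replacement -/

/-- The limit of the fibrant replacement below `p` computes the higher limits of `F`. -/
theorem isZero_higherLimit_restrictBelow_iff (hd : StrictMono d) (p : P) (k : ℕ) :
    IsZero (higherLimit (restrictBelow F p) (k + 1)) ↔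
      (limit (restrictBelow (stage d F (d p)) p)).ExactAt ((k + 1 : ℕ) : ℤ) := by
  have : WellFoundedLT P := hd.wellFoundedLT
  let α : restrictBelow F p ⋙ HomologicalComplex.single (ModuleCat.{u} R) (ComplexShape.up ℤ) 0 ⟶
      restrictBelow (stage d F (d p)) p :=
    Functor.whiskerLeft (belowInclusion p).op (stageMap d F (Nat.zero_le (d p)))
  have := quasiIso_singleToComplex α fun q => quasiIso_stageMap d F (d p) q.unop.1
  refine (isZero_higherLimit_iff (restrictBelow F p) _ (singleToComplex α) (fun k hk => ?_)
    (fun k => ?_) k).trans ?_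
  · exact Functor.isZero _ fun q => isZero_stage_neg d F (d p) q.unop.1 hk
  · refine Fib.restrictBelow (G := evalAt (stage d F (d p)) k) fun q hq => ?_
    rw [epi_matchingMap_evalAt]
    exact epi_matchingMap_stage d F hd (hd hq) k
  · exact ⟨fun h => h.of_iso (limToComplexIso _).symm, fun h => h.of_iso (limToComplexIso _)⟩

lemma exactAt_iff_epi {C : CochainComplex (ModuleCat.{u} R) ℤ} {n : ℤ} (h : IsZero (C.X (n + 1))) :
    C.ExactAt n ↔ Epi (C.d (n - 1) n) := by
  rw [C.exactAt_iff' (n - 1) n (n + 1) (by simp) (by simp)]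
  exact ShortComplex.exact_iff_epi _ (h.eq_of_tgt _ _)

lemma isZero_fibrantReplacement_iff (hd : StrictMono d) (p : P) (k : ℤ) :
    IsZero (((fibrantReplacement d hd F).obj (op p)).X k) ↔
      IsZero ((chosenFactorisation (LocallyFibrant F p)
        (matchingMap (stage d F (d p)) p)).mid.X k) := by
  rw [← stageFac_of_eq d F rfl]
  rfl

/-- Below `p`, stage `d p` already has the final values of the replacement. -/
lemma isZero_limit_stage (hd : StrictMono d) {p : P} {k : ℤ}
    (h : ∀ q < p, IsZero (((fibrantReplacement d hd F).obj (op q)).X k)) :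
    IsZero ((limit (restrictBelow (stage d F (d p)) p)).X k) := by
  refine isZero_limit_X fun q => ?_
  have hq : d q.unop.1 < d p := hd q.unop.2
  exact (isZero_X_of_isIso _ (isIso_stageMap d F q.unop.1 hq (Nat.lt_succ_self _)) k).1
    (h q.unop.1 q.unop.2)

lemma isZero_stage_self (p : P) {k : ℤ} (hk : k ≠ 0) :
    IsZero (((stage d F (d p)).obj (op p)).X k) :=
  (isZero_X_of_isIso _ (isIso_stageMap_of_le d F le_rfl) k).1 (isZero_stage_zero d F _ hk)

lemma functorHeight_le_iff {K : Pᵒᵖ ⥤ CochainComplex (ModuleCat.{u} R) ℤ} {n : ℤ} :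
    functorHeight K ≤ ((n : WithTop ℤ) : WithBot (WithTop ℤ)) ↔
      ∀ (p : P) (k : ℤ), n < k → IsZero ((K.obj (op p)).X k) := by
  rw [functorHeight, iSup_le_iff]
  exact forall_congr' fun p => height_le_iff

/-- If the higher limits in degree `n` vanish, then the fibrant replacement has height at most
`n`. -/
theorem functorHeight_le_of_isZero (hd : StrictMono d) {n : ℕ}
    (h : ∀ p : P, IsZero (higherLimit (restrictBelow F p) (n + 1))) :
    functorHeight (fibrantReplacement d hd F) ≤
      ((((n + 1 : ℕ) : ℤ) : WithTop ℤ) : WithBot (WithTop ℤ)) := by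
  have : WellFoundedLT P := hd.wellFoundedLT
  rw [functorHeight_le_iff]
  intro p
  induction p using IsWellFounded.induction (· < · : P → P → Prop) with
  | _ p ih =>
  intro k hk
  rw [isZero_fibrantReplacement_iff]
  have hD : ∀ k : ℤ, ((n + 1 : ℕ) : ℤ) < k →
      IsZero ((limit (restrictBelow (stage d F (d p)) p)).X k) := fun k hk =>
    isZero_limit_stage d F hd fun q hq => ih q hq k hk
  -- Positivity of the degree matters here: the source `F(p)`, in degree `0`, must vanish from
  -- degree `n + 1` on.
  refine height_chosenFactorisation_le (fun k hk => isZero_stage_self d F p (by omega)) hD ?_ k hk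
  exact (exactAt_iff_epi (hD _ (by omega))).1
    ((isZero_higherLimit_restrictBelow_iff d F hd p n).1 (h p))

/-- If the fibrant replacement has height at most `n`, then the higher limits in degrees at least
`n` vanish. -/
theorem isZero_of_functorHeight_le (hd : StrictMono d) {n : ℕ}
    (h : functorHeight (fibrantReplacement d hd F) ≤
      ((((n + 1 : ℕ) : ℤ) : WithTop ℤ) : WithBot (WithTop ℤ))) (p : P) {k : ℕ} (hk : n ≤ k) :
    IsZero (higherLimit (restrictBelow F p) (k + 1)) := by
  rw [functorHeight_le_iff] at h
  rw [isZero_higherLimit_restrictBelow_iff d F hd]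
  have hD : ∀ k : ℤ, ((n + 1 : ℕ) : ℤ) < k →
      IsZero ((limit (restrictBelow (stage d F (d p)) p)).X k) := fun k hk =>
    isZero_limit_stage d F hd fun q _ => h q k hk
  rcases hk.lt_or_eq with hk | rfl
  · exact HomologicalComplex.ExactAt.of_isZero (hD _ (by omega))
  -- A trivial factorisation says nothing about the height of the limit. But then everything below
  -- `p` is locally fibrant too, and the limit is concentrated in degree `0`.
  by_cases hlf : LocallyFibrant F p
  · refine HomologicalComplex.ExactAt.of_isZero (isZero_limit_X fun q => ?_)
    have hq : LocallyFibrant F q.unop.1 := fun r hr => hlf r (hr.trans q.unop.2.le)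
    exact (isZero_X_of_isIso _ (isIso_stageMap_of_locallyFibrant d F (d p) hq) _).1
      (isZero_stage_zero d F _ (by omega))
  · rw [exactAt_iff_epi (hD _ (by omega))]
    exact epi_of_isZero_chosenFactorisation hD hlf
      ((isZero_fibrantReplacement_iff d F hd p _).1 (h p _ (by omega)))

end Stages

end PosetLim

end

theorem mainTheorem5 {R : Type u} [CommRing R] {P : Type u} [PartialOrder P]
    (d : P → ℕ) (hd : StrictMono d) (F : Pᵒᵖ ⥤ ModuleCat.{u} R) (n : ℕ) (hn : 0 < n) :
    List.TFAE
      [∀ p : P, ∀ k : ℕ, n ≤ k → IsZero (PosetLim.higherLimit (PosetLim.restrictBelow F p) k),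
        ∀ p : P, IsZero (PosetLim.higherLimit (PosetLim.restrictBelow F p) n),
        PosetLim.functorHeight (PosetLim.fibrantReplacement d hd F) ≤
          (((n : ℤ) : WithTop ℤ) : WithBot (WithTop ℤ))] := by
  -- The comparison with limits of the stages is formulated for degrees of the form `k + 1`.
  obtain ⟨n, rfl⟩ := Nat.exists_eq_add_one.2 hn
  tfae_have 1 → 2 := fun h p => h p _ le_rfl
  tfae_have 2 → 3 := fun h => PosetLim.functorHeight_le_of_isZero d F hd h
  tfae_have 3 → 1 := fun h p k hk => by
    obtain ⟨k, rfl⟩ := Nat.exists_eq_add_one.2 (hn.trans_le hk)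
    exact PosetLim.isZero_of_functorHeight_le d F hd h p (by omega)
  tfae_finish
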